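/- Let $\Sigma$ be a finite alphabet containing two distinct letters $T$ and $F$, and let $\mathcal V$ be the set of binary words, used as variable names. Regular expressions with backreferences and lookaheads (REWBLk) over $\Sigma$ and $\mathcal V$ are given by $$E ::= \sigma \mid \epsilon \mid E+E \mid EE \mid E^* \mid (E)_v \mid \backslash v \mid\ ?(E) \mid\ !(E)\qquad(\sigma\in\Sigma,\ v\in\mathcal V).$$ Run on an input word $w$, an expression transforms nondeterministically a pair (position $p$, assignment $\Lambda:\mathcal V\to\Sigma^*$) into a set of such pairs: a letter $\sigma$ consumes one letter equal to $\sigma$; $\epsilon$, $+$, concatenation and $*$ mean the empty step, union, composition and finite iteration; $(E)_v$ runs $E$ and then stores the consumed factor $w[p..p')$ in $v$; $\backslash v$ consumes the word $\Lambda(v)$; $?(E)$ runs $E$ and then restores the position but keeps the new assignment; $!(E)$ leaves $(p,\Lambda)$ unchanged if $E$ has no result from $(p,\Lambda)$, and fails otherwise. The language $L(E)$ is the set of words $w$ for which $E$, started at position $0$ with all variables empty, can end at position $|w|$. (1) The membership problem for REWBLk over $\Sigma$ (given an expression $E$ and a word $w$ over $\Sigma$, decide whether $w\in L(E)$) is PSPACE-hard: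 every language in PSPACE, over any finite alphabet, is reducible to it by a polynomial-time many-one reduction. (2) There is a map $Q\mapsto E_Q$ from closed prenex quantified Boolean formulas with matrix in conjunctive normal form to REWBLk expressions over $\Sigma$ such that, if $Q$ has $n$ quantifiers and $m$ clauses and $w_Q=(TF)^nT^m$, then the pair $(E_Q,w_Q)$ is computable from $Q$ in polynomial time, and $Q$ is true if and only if $w_Q\in L(E_Q)$. -/

import Mathlib

/-! ### Regular expressions with backreferences and lookaheads -/

/-- Expressions over an alphabet `A` with variables from `V`. -/
inductive REWBLk (A V : Type) : Type where
  | sym (a : A) : REWBLk A V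
  | eps : REWBLk A V
  | alt (E₁ E₂ : REWBLk A V) : REWBLk A V
  | seq (E₁ E₂ : REWBLk A V) : REWBLk A V
  | star (E : REWBLk A V) : REWBLk A V
  /-- capture `(E)_v` -/
  | capture (E : REWBLk A V) (v : V) : REWBLk A V
  /-- backreference to `v` -/
  | backref (v : V) : REWBLk A V
  /-- positive lookahead `?(E)` -/
  | look (E : REWBLk A V) : REWBLk A V
  /-- negative lookahead `!(E)` -/
  | nlook (E : REWBLk A V) : REWBLk A V

namespace REWBLk

variable {A V : Type}

/-- `iter S i` runs the nondeterministic state transformer `S` exactly `i` times in a row. -/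
def iter {X : Type} (S : X → Set X) : ℕ → X → Set X
  | 0, x => {x}
  | i + 1, x => ⋃ y ∈ S x, iter S i y

/-- The semantics of an expression on the input `w`: the set of all pairs (position, assignment)
that can result from running it from a given position under a given assignment. -/
def sem [DecidableEq V] (w : List A) :
    REWBLk A V → ℕ × (V → List A) → Set (ℕ × (V → List A))
  | sym a, c => {c' | w[c.1]? = some a ∧ c' = (c.1 + 1, c.2)}
  | eps, c => {c}
  | alt E₁ E₂, c => sem w E₁ c ∪ sem w E₂ c
  | seq E₁ E₂, c => ⋃ c' ∈ sem w E₁ c, sem w E₂ c'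
  | star E, c => ⋃ i : ℕ, iter (sem w E) i c
  | capture E v, c =>
      {c' | ∃ d ∈ sem w E c, c' = (d.1, Function.update d.2 v ((w.drop c.1).take (d.1 - c.1)))}
  | backref v, c => {c' | c.2 v <+: w.drop c.1 ∧ c' = (c.1 + (c.2 v).length, c.2)}
  | look E, c => {c' | ∃ d ∈ sem w E c, c' = (c.1, d.2)}
  | nlook E, c => {c' | sem w E c = ∅ ∧ c' = c}

/-- The language of an expression: the whole input has to be consumed, and all variables hold the
empty word at the beginning. -/
def language [DecidableEq V] (E : REWBLk A V) : Language A :=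
  {w | ∃ Λ : V → List A, (w.length, Λ) ∈ sem w E (0, fun _ => [])}

/-- The finite alphabet in which instances of the membership problem are written. -/
inductive Token (A : Type) : Type where
  | sym (a : A)
  | eps
  | alt
  | seq
  | star
  | capture
  | backref
  | look
  | nlook
  | bit (b : Bool)
  | sep

/-- A variable name is written as its bits, followed by a terminator. -/
def encodeName (A : Type) (v : List Bool) : List (Token A) :=
  v.map Token.bit ++ [Token.sep]

/-- Expressions are written in prefix notation; variables are named by binary words. -/
def encode : REWBLk A (List Bool) → List (Token A)
  | sym a => [Token.sym a]
  | eps => [Token.eps]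
  | alt E₁ E₂ => Token.alt :: (encode E₁ ++ encode E₂)
  | seq E₁ E₂ => Token.seq :: (encode E₁ ++ encode E₂)
  | star E => Token.star :: encode E
  | capture E v => Token.capture :: (encodeName A v ++ encode E)
  | backref v => Token.backref :: encodeName A v
  | look E => Token.look :: encode E
  | nlook E => Token.nlook :: encode E

/-- The code of an instance `(E, w)` of the membership problem. -/
def encodeInstance (x : REWBLk A (List Bool) × List A) : List (Token A) :=
  encode x.1 ++ Token.sep :: x.2.map Token.sym

theorem encodeName_append_inj {v v' : List Bool} {s s' : List (Token A)}
    (h : encodeName A v ++ s = encodeName A v' ++ s') : v = v' ∧ s = s' := by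
  induction v generalizing v' with
  | nil => cases v' <;> simp_all [encodeName]
  | cons b v ih =>
    cases v' with
    | nil => simp [encodeName] at h
    | cons b' v' =>
      simp only [encodeName, List.map_cons, List.cons_append, List.cons.injEq,
        Token.bit.injEq] at h
      obtain ⟨rfl, h⟩ := h
      obtain ⟨rfl, rfl⟩ := ih (v' := v') h
      exact ⟨rfl, rfl⟩

theorem encode_append_inj {E E' : REWBLk A (List Bool)} {s s' : List (Token A)}
    (h : encode E ++ s = encode E' ++ s') : E = E' ∧ s = s' := by
  induction E generalizing E' s s' with
  | sym a => cases E' <;> simp_all [encode]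
  | eps => cases E' <;> simp_all [encode]
  | alt E₁ E₂ ih₁ ih₂ =>
    cases E' <;> simp only [encode, List.cons_append, List.append_assoc, List.cons.injEq,
      reduceCtorEq, false_and, true_and] at h
    obtain ⟨rfl, h'⟩ := ih₁ h
    obtain ⟨rfl, rfl⟩ := ih₂ h'
    exact ⟨rfl, rfl⟩
  | seq E₁ E₂ ih₁ ih₂ =>
    cases E' <;> simp only [encode, List.cons_append, List.append_assoc, List.cons.injEq,
      reduceCtorEq, false_and, true_and] at h
    obtain ⟨rfl, h'⟩ := ih₁ h
    obtain ⟨rfl, rfl⟩ := ih₂ h'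
    exact ⟨rfl, rfl⟩
  | star E ih =>
    cases E' <;> simp only [encode, List.cons_append, List.cons.injEq,
      reduceCtorEq, false_and, true_and] at h
    obtain ⟨rfl, rfl⟩ := ih h
    exact ⟨rfl, rfl⟩
  | capture E v ih =>
    cases E' <;> simp only [encode, List.cons_append, List.append_assoc, List.cons.injEq,
      reduceCtorEq, false_and, true_and] at h
    obtain ⟨rfl, h'⟩ := encodeName_append_inj h
    obtain ⟨rfl, rfl⟩ := ih h'
    exact ⟨rfl, rfl⟩
  | backref v =>
    cases E' <;> simp only [encode, List.cons_append, List.cons.injEq,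
      reduceCtorEq, false_and, true_and] at h
    obtain ⟨rfl, rfl⟩ := encodeName_append_inj h
    exact ⟨rfl, rfl⟩
  | look E ih =>
    cases E' <;> simp only [encode, List.cons_append, List.cons.injEq,
      reduceCtorEq, false_and, true_and] at h
    obtain ⟨rfl, rfl⟩ := ih h
    exact ⟨rfl, rfl⟩
  | nlook E ih =>
    cases E' <;> simp only [encode, List.cons_append, List.cons.injEq,
      reduceCtorEq, false_and, true_and] at h
    obtain ⟨rfl, rfl⟩ := ih h
    exact ⟨rfl, rfl⟩

/-- Distinct instances have distinct codes. -/
theorem encodeInstance_injective :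
    Function.Injective (encodeInstance : REWBLk A (List Bool) × List A → List (Token A)) := by
  rintro ⟨E, w⟩ ⟨E', w'⟩ h
  obtain ⟨hE, hw⟩ := encode_append_inj h
  have hinj : Function.Injective (Token.sym : A → Token A) := fun _ _ h => Token.sym.inj h
  rw [List.cons.injEq] at hw
  exact Prod.ext hE (hinj.list_map hw.2)

/-- The (uniform) membership problem over the alphabet `A`: given an expression `E` and a word `w`,
is `w` in the language of `E`? -/
def membershipProblem (A : Type) : Language (Token A) :=
  {s | ∃ (E : REWBLk A (List Bool)) (w : List A), w ∈ E.language ∧ s = encodeInstance (E, w)}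

end REWBLk

/-! ### Polynomial space -/

/-- Deterministic single-tape Turing machines with input alphabet `α`. -/
structure DTM (α : Type) where
  /-- states -/
  Q : Type
  /-- tape symbols -/
  Γ : Type
  finite_Q : Finite Q
  finite_Γ : Finite Γ
  blank : Γ
  input : α ↪ Γ
  input_ne_blank : ∀ a, input a ≠ blank
  δ : Q → Γ → Q × Γ × Turing.Dir
  start : Q
  accept : Q
  reject : Q
  accept_ne_reject : accept ≠ reject

namespace DTM

variable {α : Type}

/-- Configurations; the tape is infinite in both directions. -/
structure Cfg (M : DTM α) where
  state : M.Q
  head : ℤ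
  tape : ℤ → M.Γ

/-- The input stands in the cells `0, …, |w| - 1`, and the head is on the cell `0`. -/
def initial (M : DTM α) (w : List α) : M.Cfg where
  state := M.start
  head := 0
  tape
    | Int.ofNat i => (w[i]?).elim M.blank M.input
    | Int.negSucc _ => M.blank

/-- One step of computation; there is none from the accepting and the rejecting state. -/
def Step (M : DTM α) (c c' : M.Cfg) : Prop :=
  c.state ≠ M.accept ∧ c.state ≠ M.reject ∧
    ∃ (q : M.Q) (x : M.Γ) (d : Turing.Dir), M.δ c.state (c.tape c.head) = (q, x, d) ∧
      c'.state = q ∧ c'.tape = Function.update c.tape c.head x ∧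
      c'.head = (match d with
        | Turing.Dir.left => c.head - 1
        | Turing.Dir.right => c.head + 1)

/-- The configurations that occur in the computation of `M` on `w`. -/
def Reaches (M : DTM α) (w : List α) (c : M.Cfg) : Prop :=
  Relation.ReflTransGen M.Step (M.initial w) c

/-- `M` halts on every input, accepting exactly the words of `L`. -/
def Decides (M : DTM α) (L : Language α) : Prop :=
  ∀ w : List α,
    (w ∈ L → ∃ c : M.Cfg, M.Reaches w c ∧ c.state = M.accept) ∧
    (w ∉ L → ∃ c : M.Cfg, M.Reaches w c ∧ c.state = M.reject)

/-- The number of tape cells that `M` scans on the input `w`. -/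
noncomputable def space (M : DTM α) (w : List α) : ℕ∞ :=
  Set.encard {z : ℤ | ∃ c : M.Cfg, M.Reaches w c ∧ c.head = z}

end DTM

/-- `L` is decidable in polynomial space. -/
def InPSPACE {α : Type} (L : Language α) : Prop :=
  ∃ (M : DTM α) (p : Polynomial ℕ), M.Decides L ∧
    ∀ w : List α, M.space w ≤ ((p.eval w.length : ℕ) : ℕ∞)

/-- `f` is computable in polynomial time, inputs and outputs being written as words by means of
`ea` and `eb`. -/
def PolyTime {X Y α β : Type} (ea : X → List α) (eb : Y → List β) (f : X → Y) : Prop :=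
  Nonempty (Turing.TM2ComputableInPolyTime ea eb f)

/-- Polynomial-time many-one reducibility. -/
def PolyReducible {α β : Type} (L : Language α) (L' : Language β) : Prop :=
  ∃ f : List α → List β, PolyTime id id f ∧ ∀ w : List α, w ∈ L ↔ f w ∈ L'

/-- Every language in PSPACE (over any finite alphabet) reduces to `L'` in polynomial time. -/
def PSPACEHard {β : Type} (L' : Language β) : Prop :=
  ∀ (α : Type) [Finite α] (L : Language α), InPSPACE L → PolyReducible L L'

/-! ### Quantified Boolean formulas in conjunctive normal form -/

/-- A closed prenex quantified Boolean formula with matrix in CNF; variables are named by binary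
words. -/
structure QBF where
  /-- the quantifiers from the outermost to the innermost; `true` stands for `∃` -/
  quants : List (Bool × List Bool)
  /-- the clauses, as lists of literals; `(true, v)` stands for `v` and `(false, v)` for `¬ v` -/
  clauses : List (List (Bool × List Bool))
  closed : ∀ C ∈ clauses, ∀ l ∈ C, ∃ q ∈ quants, q.2 = l.2

namespace QBF

/-- The assignment `σ` satisfies every clause. -/
def SatCNF (cs : List (List (Bool × List Bool))) (σ : List Bool → Bool) : Prop :=
  ∀ C ∈ cs, ∃ l ∈ C, σ l.2 = l.1

/-- The truth value of a quantified formula under an assignment of its free variables. -/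
def Holds (cs : List (List (Bool × List Bool))) :
    List (Bool × List Bool) → (List Bool → Bool) → Prop
  | [], σ => SatCNF cs σ
  | (true, v) :: qs, σ => ∃ b : Bool, Holds cs qs (Function.update σ v b)
  | (false, v) :: qs, σ => ∀ b : Bool, Holds cs qs (Function.update σ v b)

/-- The truth value of a closed formula. The initial assignment plays no role, as every variable
of the matrix is quantified. -/
def IsTrue (Q : QBF) : Prop :=
  Holds Q.clauses Q.quants (fun _ => false)

/-- The finite alphabet in which formulas are written. -/
inductive Token : Type where
  | quant (isEx : Bool)
  | clause
  | lit (isPos : Bool)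
  | bit (b : Bool)
  | sep

/-- A variable name is written as its bits, followed by a terminator. -/
def encodeName (v : List Bool) : List Token :=
  v.map Token.bit ++ [Token.sep]

/-- A quantifier or literal is written as a kind symbol followed by the name of its variable; a
clause as a clause symbol followed by its literals. -/
def encode (Q : QBF) : List Token :=
  Q.quants.flatMap (fun q => Token.quant q.1 :: encodeName q.2) ++
    Q.clauses.flatMap (fun C =>
      Token.clause :: C.flatMap (fun l => Token.lit l.1 :: encodeName l.2))

end QBF

/-- The word `TF ⋯ TF T ⋯ T` with `n` blocks `TF` followed by `m` letters `T`. -/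
def tfWord {A : Type} (T F : A) (n m : ℕ) : List A :=
  (List.replicate n [T, F]).flatten ++ List.replicate m T

/-! ### Structured programs for stack machines -/

/-! Both reductions keep the reading position at `0` and compute only with the assignment: `look
(capture …)` writes a variable and returns to the start, and a lookahead around a backreference
tests one.

(1) Hardness is obtained by simulating a polynomial-space machine directly, not through quantified
formulas. States, tape symbols and directions are numbered by `0, …, K`, where `K` depends on the
machine only, and the input word is the fixed word `T^K F`. A variable holds the number `j` as the
word `T^j`. Such a number can be set, copied, and tested: after consuming `T^j` the remaining word
`T^(K-j) F` identifies `j`. There is one variable per tape cell. The head never moves; it stays on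
cell `H`, and the whole tape is shifted by a chain of copies, so that one step is an expression of
polynomial length. The star iterates this step, and the accepting state is tested at the end
(`acts_stepExpr`, `mem_language_simExpr`). Since `H` is at least twice the space bound, the cells
that matter never leave the window `0, …, 2H`.

(2) A true variable holds `T`, a false one the empty word. The word of the formula begins with
exactly one `T`, so the backreference to `v` followed by `T` matches at position `0` exactly when
`v` is false. An existential quantifier becomes a nondeterministic capture of `T` or the empty word;
a universal one is written as "not exists not" with two negative lookaheads. At the end `(T+F)*`
consumes the word (`sem_qbfTest`, `isTrue_iff_mem_language`).

For the time bounds, a small structured language over stacks is compiled to `TM2` machines with step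
counts (`Exec`, `polyTime_of_exec`). In prefix notation both outputs can be printed from left to
right with a few unary counters (`QBFPrinter.runs_prog`, `SimPrinter.runs_prog`). -/

open Turing in
/-- `c'` is reached from `c` in at most `t` steps. -/
def TM2ReachesIn {K : Type} [DecidableEq K] {Γ : K → Type} {Λ σ : Type}
    (m : Λ → TM2.Stmt Γ Λ σ) (t : ℕ) (c c' : TM2.Cfg Γ Λ σ) : Prop :=
  ∃ s ≤ t, (flip bind (TM2.step m))^[s] (some c) = some c'

namespace TM2ReachesIn

open Turing

variable {K : Type} [DecidableEq K] {Γ : K → Type} {Λ σ : Type} {m : Λ → TM2.Stmt Γ Λ σ}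

theorem trans {t t' : ℕ} {a b c : TM2.Cfg Γ Λ σ} (h : TM2ReachesIn m t a b)
    (h' : TM2ReachesIn m t' b c) : TM2ReachesIn m (t + t') a c := by
  obtain ⟨s, hs, h⟩ := h
  obtain ⟨s', hs', h'⟩ := h'
  refine ⟨s' + s, by omega, ?_⟩
  rw [Function.iterate_add_apply, h, h']

theorem single {l : Λ} {v : σ} {S : ∀ k, List (Γ k)} :
    TM2ReachesIn m 1 ⟨some l, v, S⟩ (TM2.stepAux (m l) v S) :=
  ⟨1, le_rfl, rfl⟩

theorem mono {t t' : ℕ} {a b : TM2.Cfg Γ Λ σ} (h : TM2ReachesIn m t a b) (ht : t ≤ t') :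
    TM2ReachesIn m t' a b := by
  obtain ⟨s, hs, h⟩ := h
  exact ⟨s, hs.trans ht, h⟩

end TM2ReachesIn

/-- Structured programs acting on the stacks `Γ k`. -/
inductive StackProg {K : Type} (Γ : K → Type) : Type where
  | skip : StackProg Γ
  | push (k : K) (a : Γ k) : StackProg Γ
  | seq (p q : StackProg Γ) : StackProg Γ
  /-- pop a symbol and branch on it -/
  | pop (k : K) (f : Option (Γ k) → StackProg Γ) : StackProg Γ
  /-- pop symbols and treat each of them by `f`, until the stack is empty or a symbol with
  `brk x = true` has been popped -/
  | loop (k : K) (brk : Γ k → Bool) (f : Γ k → StackProg Γ) : StackProg Γ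

namespace StackProg

open Turing

variable {K : Type} {Γ : K → Type}

/-- The labels of the machine that runs a program. -/
def Label : StackProg Γ → Type
  | skip => Unit
  | push _ _ => Unit
  | seq p q => Label p ⊕ Label q
  | pop _ f => Option (Σ o, Label (f o))
  | loop _ _ f => Option (Σ x, Label (f x))

/-- The label at which a program starts. -/
def entry : (p : StackProg Γ) → Label p
  | skip => ()
  | push _ _ => ()
  | seq p _ => Sum.inl (entry p)
  | pop _ _ => none
  | loop _ _ _ => none

theorem finite_label [∀ k, Finite (Γ k)] (p : StackProg Γ) : Finite (Label p) := by
  induction p with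
  | skip => exact inferInstanceAs (Finite Unit)
  | push => exact inferInstanceAs (Finite Unit)
  | seq p q hp hq => exact inferInstanceAs (Finite (Label p ⊕ Label q))
  | pop k f hf => exact inferInstanceAs (Finite (Option (Σ o, Label (f o))))
  | loop k b f hf => exact inferInstanceAs (Finite (Option (Σ x, Label (f x))))

variable [DecidableEq K]

/-- The machine statements of a program whose labels are placed by `e` and which continues with the
statement `ex`. -/
def code {Λ : Type} : (p : StackProg Γ) → (Label p → Λ) →
    TM2.Stmt Γ Λ (∀ k, Option (Γ k)) → Label p → TM2.Stmt Γ Λ (∀ k, Option (Γ k))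
  | skip, _, ex, _ => ex
  | push k a, _, ex, _ => TM2.Stmt.push k (fun _ => a) ex
  | seq p q, e, _, Sum.inl l =>
      code p (fun l => e (Sum.inl l)) (TM2.Stmt.goto fun _ => e (Sum.inr (entry q))) l
  | seq _ q, e, ex, Sum.inr l => code q (fun l => e (Sum.inr l)) ex l
  | pop k f, e, _, none =>
      TM2.Stmt.pop k (fun v o => Function.update v k o)
        (TM2.Stmt.goto fun v => e (some ⟨v k, entry (f (v k))⟩))
  | pop _ f, e, ex, some ⟨o, l⟩ => code (f o) (fun l => e (some ⟨o, l⟩)) ex l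
  | loop k brk f, e, ex, none =>
      TM2.Stmt.pop k (fun v o => Function.update v k o)
        (TM2.Stmt.branch (fun v => (v k).elim true brk) ex
          (TM2.Stmt.goto fun v =>
            (v k).elim (e none) (fun x => e (some ⟨x, entry (f x)⟩))))
  | loop _ _ f, e, _, some ⟨x, l⟩ =>
      code (f x) (fun l => e (some ⟨x, l⟩)) (TM2.Stmt.goto fun _ => e none) l

/-- The program `p` turns the stacks `S` into the stacks `S'` in at most `t` machine steps. -/
def Exec (p : StackProg Γ) (S S' : ∀ k, List (Γ k)) (t : ℕ) : Prop :=
  ∀ (Λ : Type) (m : Λ → TM2.Stmt Γ Λ (∀ k, Option (Γ k))) (e : Label p → Λ)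
    (ex : TM2.Stmt Γ Λ (∀ k, Option (Γ k))), (∀ l, m (e l) = code p e ex l) →
    ∀ v, ∃ v', TM2ReachesIn m t ⟨some (e (entry p)), v, S⟩ (TM2.stepAux ex v' S')

namespace Exec

variable {S S' S'' : ∀ k, List (Γ k)} {t t' : ℕ}

theorem mono {p : StackProg Γ} (h : Exec p S S' t) (ht : t ≤ t') : Exec p S S' t' := by
  intro Λ m e ex hm v
  obtain ⟨v', h⟩ := h Λ m e ex hm v
  exact ⟨v', h.mono ht⟩

theorem congr {p : StackProg Γ} {S₁ S₂ : ∀ k, List (Γ k)} (h : Exec p S S' t) (e : S₁ = S)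
    (e' : S' = S₂) : Exec p S₁ S₂ t := by
  rwa [e, ← e']

theorem skip : Exec (StackProg.skip : StackProg Γ) S S 1 := by
  intro Λ m e ex hm v
  refine ⟨v, ?_⟩
  have h := TM2ReachesIn.single (m := m) (l := e (entry StackProg.skip)) (v := v) (S := S)
  rwa [hm] at h

theorem push {k : K} {a : Γ k} :
    Exec (StackProg.push k a) S (Function.update S k (a :: S k)) 1 := by
  intro Λ m e ex hm v
  refine ⟨v, ?_⟩
  have h := TM2ReachesIn.single (m := m) (l := e (entry (StackProg.push k a))) (v := v) (S := S)
  rwa [hm] at h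

/-- The exit statement of `p` is a jump to the entry of `q`. Programs compose because `Exec`
quantifies over the host machine, the placement of the labels and the exit statement. -/
theorem seq {p q : StackProg Γ} (h : Exec p S S' t) (h' : Exec q S' S'' t') :
    Exec (StackProg.seq p q) S S'' (t + t') := by
  intro Λ m e ex hm v
  obtain ⟨v', h⟩ := h Λ m (fun l => e (Sum.inl l)) _ (fun l => hm (Sum.inl l)) v
  obtain ⟨v'', h'⟩ := h' Λ m (fun l => e (Sum.inr l)) _ (fun l => hm (Sum.inr l)) v'
  exact ⟨v'', h.trans h'⟩

theorem pop {k : K} {f : Option (Γ k) → StackProg Γ}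
    (h : Exec (f (S k).head?) (Function.update S k (S k).tail) S' t) :
    Exec (StackProg.pop k f) S S' (t + 1) := by
  intro Λ m e ex hm v
  -- The machine chooses the branch from its register for stack `k`, so the hypothesis is restated
  -- with the content of that register in place of the popped symbol.
  replace h : Exec (f (Function.update v k (S k).head? k)) (Function.update S k (S k).tail) S' t := by
    rwa [Function.update_self]
  obtain ⟨v', h⟩ := h Λ m (fun l => e (some ⟨_, l⟩)) ex (fun l => hm (some ⟨_, l⟩))
    (Function.update v k (S k).head?)
  refine ⟨v', ?_⟩
  have h1 := TM2ReachesIn.single (m := m) (l := e (entry (StackProg.pop k f))) (v := v) (S := S)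
  rw [hm] at h1
  rw [add_comm]
  exact h1.trans h

/-- Popping an empty stack puts `none` into the register, which the branch treats like a breaking
symbol. -/
theorem loop_nil {k : K} {brk : Γ k → Bool} {f : Γ k → StackProg Γ} (hk : S k = []) :
    Exec (StackProg.loop k brk f) S S 1 := by
  intro Λ m e ex hm v
  refine ⟨Function.update v k none, ?_⟩
  have h1 := TM2ReachesIn.single (m := m) (l := e (entry (StackProg.loop k brk f))) (v := v) (S := S)
  rw [hm] at h1
  have h2 : Function.update S k [] = S := by rw [← hk, Function.update_eq_self]
  simpa [entry, code, hk, h2] using h1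

theorem loop_break {k : K} {brk : Γ k → Bool} {f : Γ k → StackProg Γ} {x : Γ k} {r : List (Γ k)}
    (hk : S k = x :: r) (hx : brk x = true) :
    Exec (StackProg.loop k brk f) S (Function.update S k r) 1 := by
  intro Λ m e ex hm v
  refine ⟨Function.update v k (some x), ?_⟩
  have h1 := TM2ReachesIn.single (m := m) (l := e (entry (StackProg.loop k brk f))) (v := v) (S := S)
  rw [hm] at h1
  simpa [entry, code, hk, hx] using h1

theorem loop_cons {k : K} {brk : Γ k → Bool} {f : Γ k → StackProg Γ} {x : Γ k} {r : List (Γ k)}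
    (hk : S k = x :: r) (hx : brk x = false) (h : Exec (f x) (Function.update S k r) S' t)
    (h' : Exec (StackProg.loop k brk f) S' S'' t') :
    Exec (StackProg.loop k brk f) S S'' (t + t' + 1) := by
  intro Λ m e ex hm v
  obtain ⟨v', h⟩ := h Λ m (fun l => e (some ⟨_, l⟩)) _ (fun l => hm (some ⟨_, l⟩))
    (Function.update v k (some x))
  obtain ⟨v'', h'⟩ := h' Λ m e ex hm v'
  refine ⟨v'', ?_⟩
  have h1 := TM2ReachesIn.single (m := m) (l := e (entry (StackProg.loop k brk f))) (v := v) (S := S)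
  rw [hm] at h1
  rw [add_comm]
  refine h1.trans ?_
  have h2 := h.trans h'
  simpa [entry, code, hk, hx] using h2

end Exec

/-- Replaces the dependent case distinction in `initList` by `Function.update`, the form in which
stacks are given to `Exec`. -/
theorem initList_eq (tm : FinTM2) (s : List (tm.Γ tm.k₀)) :
    initList tm s = ⟨some tm.main, tm.initialState, Function.update (fun _ => []) tm.k₀ s⟩ := by
  unfold initList
  congr 1
  funext k
  by_cases hk : k = tm.k₀
  · subst hk
    simp
  · simp [hk]

theorem haltList_eq (tm : FinTM2) (s : List (tm.Γ tm.k₁)) :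
    haltList tm s = ⟨none, tm.initialState, Function.update (fun _ => []) tm.k₁ s⟩ := by
  unfold haltList
  congr 1
  funext k
  by_cases hk : k = tm.k₁
  · subst hk
    simp
  · simp [hk]

/-- A program that turns every input into the right output within a polynomial time bound makes a
function computable in polynomial time. -/
theorem polyTime_of_exec [Fintype K] [∀ k, Finite (Γ k)] (p : StackProg Γ) (k₀ k₁ : K)
    {X Y : Type} {ea : X → List (Γ k₀)} {eb : Y → List (Γ k₁)} {f : X → Y} (P : Polynomial ℕ)
    (h : ∀ x, Exec p (Function.update (fun _ => []) k₀ (ea x))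
      (Function.update (fun _ => []) k₁ (eb (f x))) (P.eval (ea x).length)) :
    PolyTime ea eb f := by
  classical
  have := finite_label p
  let _ : Fintype (Label p) := Fintype.ofFinite _
  let _ : ∀ k, Fintype (Γ k) := fun k => Fintype.ofFinite _
  let tm : FinTM2 :=
    { K := K, k₀ := k₀, k₁ := k₁, Γ := Γ, Λ := Label p, main := entry p
      σ := ∀ k, Option (Γ k), initialState := fun _ => none
      -- The registers are cleared before halting because `haltList` demands the initial internal
      -- state.
      m := code p id (TM2.Stmt.load (fun _ _ => none) TM2.Stmt.halt) }
  refine ⟨{ tm := tm, inputAlphabet := Equiv.refl _, outputAlphabet := Equiv.refl _, time := P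
            outputsFun := fun x => Classical.choice ?_ }⟩
  obtain ⟨v', s, hs, hr⟩ := h x (Label p) tm.m id _ (fun _ => rfl) (fun _ => none)
  have h0 := initList_eq tm (List.map (Equiv.refl (Γ k₀)).invFun (ea x))
  have h1 := haltList_eq tm (List.map (Equiv.refl (Γ k₁)).invFun (eb (f x)))
  rw [show List.map (Equiv.refl (Γ k₀)).invFun (ea x) = ea x from List.map_id _] at h0
  rw [show List.map (Equiv.refl (Γ k₁)).invFun (eb (f x)) = eb (f x) from List.map_id _] at h1
  refine ⟨⟨s, ?_⟩, hs⟩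
  change (flip bind tm.step)^[s] (some (initList tm (List.map (Equiv.refl (Γ k₀)).invFun (ea x)))) =
    some (haltList tm (List.map (Equiv.refl (Γ k₁)).invFun (eb (f x))))
  rw [show List.map (Equiv.refl (Γ k₀)).invFun (ea x) = ea x from List.map_id _,
    show List.map (Equiv.refl (Γ k₁)).invFun (eb (f x)) = eb (f x) from List.map_id _]
  exact ((congrArg (fun c => (flip bind tm.step)^[s] (some c)) h0).trans hr).trans
    (congrArg some h1).symm

end StackProg

/-! ### A fixed set of stacks -/

namespace StackProg

/-- Names of the stacks that serve as unary counters. -/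
inductive Ctr : Type where
  | n | h | k | a | b | t
  deriving DecidableEq

instance : Fintype Ctr where
  elems := {Ctr.n, Ctr.h, Ctr.k, Ctr.a, Ctr.b, Ctr.t}
  complete i := by cases i <;> decide

/-- Names of stacks: two for input symbols, two for output symbols, and counters. -/
inductive Stk : Type where
  | inp | inp2 | rev | out
  | ctr (i : Ctr)
  deriving DecidableEq

instance : Fintype Stk :=
  Fintype.ofSurjective
    (fun o : Option (Option (Option (Option Ctr))) => match o with
      | none => Stk.inp
      | some none => Stk.inp2
      | some (some none) => Stk.rev
      | some (some (some none)) => Stk.out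
      | some (some (some (some i))) => Stk.ctr i)
    (fun s => match s with
      | Stk.inp => ⟨none, rfl⟩
      | Stk.inp2 => ⟨some none, rfl⟩
      | Stk.rev => ⟨some (some none), rfl⟩
      | Stk.out => ⟨some (some (some none)), rfl⟩
      | Stk.ctr i => ⟨some (some (some (some i))), rfl⟩)

/-- The alphabets of the stacks. -/
def Sym (α β : Type) : Stk → Type
  | Stk.inp => α
  | Stk.inp2 => α
  | Stk.rev => β
  | Stk.out => β
  | Stk.ctr _ => Unit

instance finite_sym (α β : Type) [Finite α] [Finite β] : ∀ k, Finite (Sym α β k)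
  | Stk.inp => inferInstanceAs (Finite α)
  | Stk.inp2 => inferInstanceAs (Finite α)
  | Stk.rev => inferInstanceAs (Finite β)
  | Stk.out => inferInstanceAs (Finite β)
  | Stk.ctr _ => inferInstanceAs (Finite Unit)

/-- The contents of the stacks, counters being given as numbers. -/
structure Store (α β : Type) where
  inp : List α
  inp2 : List α
  rev : List β
  out : List β
  n : ℕ
  h : ℕ
  k : ℕ
  a : ℕ
  b : ℕ
  t : ℕ

namespace Store

variable {α β : Type}

/-- The value of a counter. -/
def get (s : Store α β) : Ctr → ℕ
  | Ctr.n => s.n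
  | Ctr.h => s.h
  | Ctr.k => s.k
  | Ctr.a => s.a
  | Ctr.b => s.b
  | Ctr.t => s.t

/-- Replace the value of a counter. -/
def set (s : Store α β) : Ctr → ℕ → Store α β
  | Ctr.n, m => { s with n := m }
  | Ctr.h, m => { s with h := m }
  | Ctr.k, m => { s with k := m }
  | Ctr.a, m => { s with a := m }
  | Ctr.b, m => { s with b := m }
  | Ctr.t, m => { s with t := m }

/-- The contents of the stacks as words. -/
def toStk (s : Store α β) : ∀ k, List (Sym α β k)
  | Stk.inp => s.inp
  | Stk.inp2 => s.inp2
  | Stk.rev => s.rev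
  | Stk.out => s.out
  | Stk.ctr i => List.replicate (s.get i) ()

/-- Only the input stack is used. -/
def ofInp (l : List α) : Store α β := ⟨l, [], [], [], 0, 0, 0, 0, 0, 0⟩

/-- Only the output stack is used. -/
def ofOut (l : List β) : Store α β := ⟨[], [], [], l, 0, 0, 0, 0, 0, 0⟩

theorem update_inp (s : Store α β) (l : List α) :
    Function.update s.toStk Stk.inp l = ({ s with inp := l } : Store α β).toStk := by
  funext k
  rcases k with _ | _ | _ | _ | (_ | _ | _ | _ | _ | _) <;> rfl

theorem update_inp2 (s : Store α β) (l : List α) :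
    Function.update s.toStk Stk.inp2 l = ({ s with inp2 := l } : Store α β).toStk := by
  funext k
  rcases k with _ | _ | _ | _ | (_ | _ | _ | _ | _ | _) <;> rfl

theorem update_rev (s : Store α β) (l : List β) :
    Function.update s.toStk Stk.rev l = ({ s with rev := l } : Store α β).toStk := by
  funext k
  rcases k with _ | _ | _ | _ | (_ | _ | _ | _ | _ | _) <;> rfl

theorem update_out (s : Store α β) (l : List β) :
    Function.update s.toStk Stk.out l = ({ s with out := l } : Store α β).toStk := by
  funext k
  rcases k with _ | _ | _ | _ | (_ | _ | _ | _ | _ | _) <;> rfl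

theorem update_ctr (s : Store α β) (i : Ctr) (m : ℕ) :
    Function.update s.toStk (Stk.ctr i) (List.replicate m ()) = (s.set i m).toStk := by
  funext k
  rcases i with _ | _ | _ | _ | _ | _ <;>
    rcases k with _ | _ | _ | _ | (_ | _ | _ | _ | _ | _) <;> rfl

theorem toStk_ofInp (l : List α) :
    (ofInp l : Store α β).toStk = Function.update (β := fun k => List (Sym α β k)) (fun _ => []) Stk.inp l := by
  funext k
  rcases k with _ | _ | _ | _ | (_ | _ | _ | _ | _ | _) <;> rfl

theorem toStk_ofOut (l : List β) :
    (ofOut l : Store α β).toStk = Function.update (β := fun k => List (Sym α β k)) (fun _ => []) Stk.out l := by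
  funext k
  rcases k with _ | _ | _ | _ | (_ | _ | _ | _ | _ | _) <;> rfl

end Store

variable {α β : Type}

/-- The program `p` turns the store `s` into `s'` in at most `t` machine steps. -/
def Runs (p : StackProg (Sym α β)) (s s' : Store α β) (t : ℕ) : Prop :=
  Exec p s.toStk s'.toStk t

/-- A pass through the input. -/
def forInp (f : α → StackProg (Sym α β)) : StackProg (Sym α β) :=
  loop Stk.inp (fun _ => false) f

/-- A pass through the saved input. -/
def forInp2 (f : α → StackProg (Sym α β)) : StackProg (Sym α β) :=
  loop Stk.inp2 (fun _ => false) f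

/-- Repeat until a counter is zero. -/
def forCtr (i : Ctr) (p : StackProg (Sym α β)) : StackProg (Sym α β) :=
  loop (Stk.ctr i) (fun _ => false) (fun _ => p)

/-- Increase a counter. -/
def inc (i : Ctr) : StackProg (Sym α β) := push (Stk.ctr i) ()

/-- Write a symbol. -/
def put (x : β) : StackProg (Sym α β) := push (K := Stk) (Γ := Sym α β) Stk.rev x

/-- Save an input symbol. -/
def save (x : α) : StackProg (Sym α β) := push (K := Stk) (Γ := Sym α β) Stk.inp2 x

/-- Restore an input symbol. -/
def unsave (x : α) : StackProg (Sym α β) := push (K := Stk) (Γ := Sym α β) Stk.inp x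

/-- Write a word. -/
def emit : List β → StackProg (Sym α β)
  | [] => skip
  | x :: l => seq (put x) (emit l)

/-- Write as many copies of `x` as the counter `i` says. -/
def emitCtr (x : β) (i : Ctr) : StackProg (Sym α β) :=
  seq (forCtr i (seq (put x) (inc Ctr.t))) (forCtr Ctr.t (inc i))

/-- Reverse what has been written and declare it the output. -/
def finish : StackProg (Sym α β) :=
  loop (K := Stk) (Γ := Sym α β) Stk.rev (fun _ => false) (fun x => push (K := Stk) Stk.out x)

namespace Runs

variable {s s' s'' : Store α β} {t t' : ℕ} {p q : StackProg (Sym α β)}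

theorem mono (h : Runs p s s' t) (ht : t ≤ t') : Runs p s s' t' := Exec.mono h ht

theorem seq (h : Runs p s s' t) (h' : Runs q s' s'' t') : Runs (p.seq q) s s'' (t + t') :=
  Exec.seq h h'

theorem inc (i : Ctr) : Runs (inc i) s (s.set i (s.get i + 1)) 1 := by
  unfold Runs
  rw [← Store.update_ctr]
  exact Exec.push

theorem put (x : β) : Runs (put x) s { s with rev := x :: s.rev } 1 := by
  exact Exec.congr Exec.push rfl (Store.update_rev s (x :: s.rev))

theorem save (x : α) : Runs (save x) s { s with inp2 := x :: s.inp2 } 1 := by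
  exact Exec.congr Exec.push rfl (Store.update_inp2 s (x :: s.inp2))

theorem unsave (x : α) : Runs (unsave x) s { s with inp := x :: s.inp } 1 := by
  exact Exec.congr Exec.push rfl (Store.update_inp s (x :: s.inp))

theorem emit (l : List β) : Runs (emit l) s { s with rev := l.reverse ++ s.rev } (l.length + 1) := by
  induction l generalizing s with
  | nil => exact Exec.skip
  | cons x l ih =>
    have h := (put (s := s) x).seq ih
    simp only [List.reverse_cons, List.append_assoc, List.singleton_append, List.length_cons]
    exact h.mono (by omega)

theorem loopInp_nil {brk : α → Bool} {f : α → StackProg (Sym α β)} (h : s.inp = []) :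
    Runs (loop (K := Stk) (Γ := Sym α β) Stk.inp brk f) s s 1 :=
  Exec.loop_nil (k := Stk.inp) h

theorem loopInp_break {brk : α → Bool} {f : α → StackProg (Sym α β)} {x : α} {r : List α}
    (h : s.inp = x :: r) (hx : brk x = true) :
    Runs (loop (K := Stk) (Γ := Sym α β) Stk.inp brk f) s { s with inp := r } 1 := by
  exact Exec.congr (Exec.loop_break (k := Stk.inp) h hx) rfl (Store.update_inp s r)

theorem loopInp_cons {brk : α → Bool} {f : α → StackProg (Sym α β)} {x : α} {r : List α}
    (h : s.inp = x :: r) (hx : brk x = false) (h1 : Runs (f x) { s with inp := r } s' t)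
    (h2 : Runs (loop (K := Stk) (Γ := Sym α β) Stk.inp brk f) s' s'' t') :
    Runs (loop (K := Stk) (Γ := Sym α β) Stk.inp brk f) s s'' (t + t' + 1) := by
  unfold Runs at h1
  rw [← Store.update_inp] at h1
  exact Exec.loop_cons (k := Stk.inp) h hx h1 h2

theorem loopInp2_nil {f : α → StackProg (Sym α β)} (h : s.inp2 = []) :
    Runs (forInp2 f) s s 1 :=
  Exec.loop_nil (k := Stk.inp2) h

theorem loopInp2_cons {f : α → StackProg (Sym α β)} {x : α} {r : List α}
    (h : s.inp2 = x :: r) (h1 : Runs (f x) { s with inp2 := r } s' t)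
    (h2 : Runs (forInp2 f) s' s'' t') : Runs (forInp2 f) s s'' (t + t' + 1) := by
  unfold Runs at h1
  rw [← Store.update_inp2] at h1
  exact Exec.loop_cons (k := Stk.inp2) h rfl h1 h2

theorem forCtr_zero {i : Ctr} (h : s.get i = 0) : Runs (forCtr i p) s s 1 := by
  refine Exec.loop_nil (k := Stk.ctr i) ?_
  change List.replicate (s.get i) () = []
  rw [h]
  rfl

theorem forCtr_succ {i : Ctr} {m : ℕ} (h : s.get i = m + 1) (h1 : Runs p (s.set i m) s' t)
    (h2 : Runs (forCtr i p) s' s'' t') : Runs (forCtr i p) s s'' (t + t' + 1) := by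
  unfold Runs at h1
  rw [← Store.update_ctr] at h1
  refine Exec.loop_cons (k := Stk.ctr i) (x := ()) ?_ rfl h1 h2
  change List.replicate (s.get i) () = _
  rw [h]
  rfl

/-- A loop with a counter. In `G m d` the counter is `m`, and `d` rounds are done. -/
theorem forCtr_from (i : Ctr) (G : ℕ → ℕ → Store α β) (T : ℕ) (hG : ∀ m d, (G m d).get i = m)
    (h : ∀ m d, Runs p ((G (m + 1) d).set i m) (G m (d + 1)) T) (N d : ℕ) :
    Runs (forCtr i p) (G N d) (G 0 (d + N)) (N * (T + 1) + 1) := by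
  induction N generalizing d with
  | zero => exact (forCtr_zero (hG 0 d)).mono (by simp)
  | succ m ih =>
    rw [show d + (m + 1) = d + 1 + m by omega]
    refine (forCtr_succ (hG _ _) (h m d) (ih _)).mono ?_
    rw [add_one_mul]
    omega

theorem forCtr (i : Ctr) (G : ℕ → ℕ → Store α β) (T : ℕ) (hG : ∀ m d, (G m d).get i = m)
    (h : ∀ m d, Runs p ((G (m + 1) d).set i m) (G m (d + 1)) T) (N : ℕ) :
    Runs (forCtr i p) (G N 0) (G 0 N) (N * (T + 1) + 1) := by
  have h1 := forCtr_from i G T hG h N 0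
  rwa [Nat.zero_add] at h1

theorem popCtr_zero (i : Ctr) {f : Option Unit → StackProg (Sym α β)} (h : s.get i = 0)
    (h1 : Runs (f none) s s' t) :
    Runs (pop (K := Stk) (Γ := Sym α β) (Stk.ctr i) f) s s' (t + 1) := by
  have h0 : s.toStk (Stk.ctr i) = [] := by
    change List.replicate (s.get i) () = []
    rw [h]
    rfl
  refine Exec.pop (k := Stk.ctr i) ?_
  rw [h0, List.head?_nil, List.tail_nil, ← h0, Function.update_eq_self]
  exact h1

theorem popCtr_succ (i : Ctr) {f : Option Unit → StackProg (Sym α β)} {m : ℕ}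
    (h : s.get i = m + 1) (h1 : Runs (f (some ())) (s.set i m) s' t) :
    Runs (pop (K := Stk) (Γ := Sym α β) (Stk.ctr i) f) s s' (t + 1) := by
  have h0 : s.toStk (Stk.ctr i) = () :: List.replicate m () := by
    change List.replicate (s.get i) () = _
    rw [h]
    rfl
  refine Exec.pop (k := Stk.ctr i) ?_
  rw [h0]
  unfold Runs at h1
  rw [← Store.update_ctr] at h1
  exact h1

/-- Reading a counter destroys it: it is drained into the scratch counter `t` while the copies are
written (3 steps a round), then poured back (2 steps a round). Hence `t` must be a different counter
and start at `0`. -/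
theorem emitCtr (x : β) (i : Ctr) (hi : i ≠ Ctr.t) (ht : s.t = 0) :
    Runs (emitCtr x i) s { s with rev := List.replicate (s.get i) x ++ s.rev }
      (5 * s.get i + 2) := by
  obtain ⟨i1, i2, rev, out, n, h, k, a, b, t⟩ := s
  obtain rfl : t = 0 := ht
  cases i with
  | t => exact absurd rfl hi
  | n =>
    refine mono (seq (forCtr Ctr.n
      (fun m d => ⟨i1, i2, List.replicate d x ++ rev, out, m, h, k, a, b, d⟩) 2
      (fun _ _ => rfl) (fun m d => (put x).seq (inc Ctr.t)) n) (forCtr Ctr.t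
      (fun m d => ⟨i1, i2, List.replicate n x ++ rev, out, d, h, k, a, b, m⟩) 1
      (fun _ _ => rfl) (fun m d => inc Ctr.n) n)) ?_
    change _ ≤ 5 * n + 2
    omega
  | h =>
    refine mono (seq (forCtr Ctr.h
      (fun m d => ⟨i1, i2, List.replicate d x ++ rev, out, n, m, k, a, b, d⟩) 2
      (fun _ _ => rfl) (fun m d => (put x).seq (inc Ctr.t)) h) (forCtr Ctr.t
      (fun m d => ⟨i1, i2, List.replicate h x ++ rev, out, n, d, k, a, b, m⟩) 1
      (fun _ _ => rfl) (fun m d => inc Ctr.h) h)) ?_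
    change _ ≤ 5 * h + 2
    omega
  | k =>
    refine mono (seq (forCtr Ctr.k
      (fun m d => ⟨i1, i2, List.replicate d x ++ rev, out, n, h, m, a, b, d⟩) 2
      (fun _ _ => rfl) (fun m d => (put x).seq (inc Ctr.t)) k) (forCtr Ctr.t
      (fun m d => ⟨i1, i2, List.replicate k x ++ rev, out, n, h, d, a, b, m⟩) 1
      (fun _ _ => rfl) (fun m d => inc Ctr.k) k)) ?_
    change _ ≤ 5 * k + 2
    omega
  | a =>
    refine mono (seq (forCtr Ctr.a
      (fun m d => ⟨i1, i2, List.replicate d x ++ rev, out, n, h, k, m, b, d⟩) 2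
      (fun _ _ => rfl) (fun m d => (put x).seq (inc Ctr.t)) a) (forCtr Ctr.t
      (fun m d => ⟨i1, i2, List.replicate a x ++ rev, out, n, h, k, d, b, m⟩) 1
      (fun _ _ => rfl) (fun m d => inc Ctr.a) a)) ?_
    change _ ≤ 5 * a + 2
    omega
  | b =>
    refine mono (seq (forCtr Ctr.b
      (fun m d => ⟨i1, i2, List.replicate d x ++ rev, out, n, h, k, a, m, d⟩) 2
      (fun _ _ => rfl) (fun m d => (put x).seq (inc Ctr.t)) b) (forCtr Ctr.t
      (fun m d => ⟨i1, i2, List.replicate b x ++ rev, out, n, h, k, a, d, m⟩) 1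
      (fun _ _ => rfl) (fun m d => inc Ctr.b) b)) ?_
    change _ ≤ 5 * b + 2
    omega

theorem finish (i1 i2 : List α) (rev out : List β) (n h k a b t : ℕ) :
    Runs finish ⟨i1, i2, rev, out, n, h, k, a, b, t⟩
      ⟨i1, i2, [], rev.reverse ++ out, n, h, k, a, b, t⟩ (rev.length * 2 + 1) := by
  induction rev generalizing out with
  | nil => exact Exec.loop_nil (k := Stk.rev) rfl
  | cons x l ih =>
    have h1 : Exec (push (K := Stk) (Γ := Sym α β) Stk.out x) _ _ 1 := Exec.congr Exec.push
      (Store.update_rev (Store.mk i1 i2 (x :: l) out n h k a b t) l)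
      (Store.update_out (Store.mk i1 i2 l out n h k a b t) (x :: out))
    have h2 := Exec.loop_cons (k := Stk.rev) (x := x) (r := l) rfl rfl h1 (ih (x :: out))
    rw [List.reverse_cons, List.append_assoc, List.singleton_append]
    refine Exec.mono h2 ?_
    rw [List.length_cons]
    omega

end Runs

/-- Polynomial time computability by a program on stores. -/
theorem polyTime_of_runs [Finite α] [Finite β] (p : StackProg (Sym α β)) {X Y : Type}
    {ea : X → List α} {eb : Y → List β} {f : X → Y} (P : Polynomial ℕ)
    (h : ∀ x, Runs p (Store.ofInp (ea x)) (Store.ofOut (eb (f x))) (P.eval (ea x).length)) :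
    PolyTime ea eb f := by
  refine polyTime_of_exec (K := Stk) (Γ := Sym α β) p Stk.inp Stk.out P fun x => ?_
  have h1 := h x
  unfold Runs at h1
  rwa [Store.toStk_ofInp, Store.toStk_ofOut] at h1

end StackProg

/-! ### Quantified Boolean formulas as expressions -/

namespace REWBLk

variable {A V : Type} [DecidableEq V]

theorem sem_seq_of_test {w : List A} {E₁ E₂ : REWBLk A V} {c : ℕ × (V → List A)} {p : Prop}
    (h : sem w E₁ c = {c' | p ∧ c' = c}) : sem w (seq E₁ E₂) c = {c' | p ∧ c' ∈ sem w E₂ c} := by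
  ext c'
  rw [sem, h]
  constructor
  · intro h
    obtain ⟨d, ⟨hp, rfl⟩, hd⟩ := Set.mem_iUnion₂.1 h
    exact ⟨hp, hd⟩
  · rintro ⟨hp, hd⟩
    exact Set.mem_biUnion ⟨hp, rfl⟩ hd

/-- The assignment that stores the letter `T` in the true variables. -/
def boolAsg (T : A) (σ : V → Bool) (v : V) : List A := if σ v then [T] else []

theorem boolAsg_update (T : A) (σ : V → Bool) (v : V) (b : Bool) :
    boolAsg T (Function.update σ v b) =
      Function.update (boolAsg T σ) v (if b then [T] else []) := by
  funext u
  by_cases h : u = v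
  · subst h
    simp [boolAsg]
  · simp [boolAsg, h]

/-- Give `v` an arbitrary truth value. -/
def choose (T : A) (v : V) : REWBLk A V := look (capture (alt (sym T) eps) v)

/-- Test the truth value of a literal. -/
def litTest (T : A) (l : Bool × V) : REWBLk A V :=
  if l.1 then nlook (seq (backref l.2) (sym T)) else look (seq (backref l.2) (sym T))

/-- Test a disjunction of literals. -/
def clauseTest (T : A) : List (Bool × V) → REWBLk A V
  | [] => nlook eps
  | l :: C => alt (litTest T l) (clauseTest T C)

/-- Test a conjunction of clauses. -/
def cnfTest (T : A) : List (List (Bool × V)) → REWBLk A V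
  | [] => eps
  | C :: cs => seq (clauseTest T C) (cnfTest T cs)

/-- Test a quantified formula. -/
def qbfTest (T : A) (cs : List (List (Bool × V))) : List (Bool × V) → REWBLk A V
  | [] => cnfTest T cs
  | (true, v) :: qs => seq (choose T v) (qbfTest T cs qs)
  | (false, v) :: qs => nlook (seq (choose T v) (nlook (qbfTest T cs qs)))

/-- The word begins with exactly one letter `T`. -/
def StartsOnce (T : A) (w : List A) : Prop := ∃ r, w = T :: r ∧ r[0]? ≠ some T

section

variable {T : A} {w : List A}

/-- The first letter is `T`, so both alternatives of the capture match at position `0`; the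
lookahead forgets the move but not the captured word. -/
theorem sem_choose (h : StartsOnce T w) (v : V) (σ : V → Bool) :
    sem w (choose T v) (0, boolAsg T σ) =
      {c | ∃ b, c = (0, boolAsg T (Function.update σ v b))} := by
  obtain ⟨r, rfl, hr⟩ := h
  ext c
  simp only [choose, sem, Set.mem_ofPred_eq, Set.mem_union, Set.mem_singleton_iff, boolAsg_update,
    Bool.exists_bool]
  constructor
  · rintro ⟨d, ⟨e, ⟨_, rfl⟩ | rfl, rfl⟩, rfl⟩ <;> simp
  · rintro (rfl | rfl)
    · exact ⟨_, ⟨_, Or.inr rfl, rfl⟩, by simp⟩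
    · exact ⟨_, ⟨_, Or.inl ⟨by simp, rfl⟩, rfl⟩, by simp⟩

/-- If `v` is false, the backreference is empty and the initial `T` is free to be consumed. If `v`
is true, the backreference uses up that `T`, and no second one follows. -/
theorem sem_backref_sym (h : StartsOnce T w) (v : V) (σ : V → Bool) :
    sem w (seq (backref v) (sym T)) (0, boolAsg T σ) =
      {c | σ v = false ∧ c = (1, boolAsg T σ)} := by
  obtain ⟨r, rfl, hr⟩ := h
  ext c
  cases hv : σ v
  · simp [sem, boolAsg, hv]
  · simpa [sem, boolAsg, hv] using fun h => absurd h hr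

theorem sem_litTest (h : StartsOnce T w) (l : Bool × V) (σ : V → Bool) :
    sem w (litTest T l) (0, boolAsg T σ) =
      {c | σ l.2 = l.1 ∧ c = (0, boolAsg T σ)} := by
  obtain ⟨b, v⟩ := l
  ext c
  cases b
  · simp only [litTest, Bool.false_eq_true, if_false]
    -- `sem.eq_8` and `sem.eq_9` are the equations for `look` and `nlook`; they open only the outer
    -- lookahead and leave the sequence intact for `sem_backref_sym`.
    rw [sem.eq_8, sem_backref_sym h]
    simp
  · simp only [litTest, if_true]
    rw [sem.eq_9, sem_backref_sym h]
    cases hv : σ v <;> simp [Set.eq_empty_iff_forall_notMem]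

/-- The shape of the word is required for nonempty clauses only. This covers formulas without
quantifiers, whose word has no block `TF` but whose clauses are all empty. -/
theorem sem_clauseTest {C : List (Bool × V)} (h : C ≠ [] → StartsOnce T w) (σ : V → Bool) :
    sem w (clauseTest T C) (0, boolAsg T σ) =
      {c | (∃ l ∈ C, σ l.2 = l.1) ∧ c = (0, boolAsg T σ)} := by
  induction C with
  | nil => simp [clauseTest, sem]
  | cons l C ih =>
    have h := h (by simp)
    rw [clauseTest, sem, sem_litTest h, ih fun _ => h]
    ext c
    have h1 : (∃ l' ∈ l :: C, σ l'.2 = l'.1) ↔ σ l.2 = l.1 ∨ ∃ l' ∈ C, σ l'.2 = l'.1 :=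
      List.exists_mem_cons_iff ..
    rw [Set.mem_union, Set.mem_ofPred_eq, Set.mem_ofPred_eq, Set.mem_ofPred_eq, h1, or_and_right]

theorem sem_cnfTest {cs : List (List (Bool × V))} (h : ∀ C ∈ cs, C ≠ [] → StartsOnce T w)
    (σ : V → Bool) :
    sem w (cnfTest T cs) (0, boolAsg T σ) =
      {c | (∀ C ∈ cs, ∃ l ∈ C, σ l.2 = l.1) ∧ c = (0, boolAsg T σ)} := by
  induction cs with
  | nil => simp [cnfTest, sem]
  | cons C cs ih =>
    rw [cnfTest, sem_seq_of_test (sem_clauseTest (h C (by simp)) σ),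
      ih fun C hC => h C (List.mem_cons_of_mem _ hC)]
    ext c
    simp [and_assoc]

/-- By induction on the prefix. The choices made for existential variables survive in the
assignment, so the expression is not a pure test; what matters outside is only whether there is a
result and that the position is still `0`. Under a negative lookahead the changed assignments
disappear. -/
theorem sem_qbfTest {cs : List (List (Bool × List Bool))} {qs : List (Bool × List Bool)}
    (hcs : ∀ C ∈ cs, C ≠ [] → StartsOnce T w) (hqs : qs ≠ [] → StartsOnce T w)
    (σ : List Bool → Bool) :
    ((sem w (qbfTest T cs qs) (0, boolAsg T σ)).Nonempty ↔ QBF.Holds cs qs σ) ∧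
      ∀ c ∈ sem w (qbfTest T cs qs) (0, boolAsg T σ), c.1 = 0 := by
  induction qs generalizing σ with
  | nil =>
    rw [qbfTest, sem_cnfTest hcs]
    refine ⟨?_, by simp +contextual⟩
    simp [Set.Nonempty, QBF.Holds, QBF.SatCNF]
  | cons q qs ih =>
    have hw := hqs (by simp)
    replace ih := ih fun _ => hw
    obtain ⟨_ | _, v⟩ := q
    -- The results of the inner part are the values of `v` that refute the rest of the formula; the
    -- outer `nlook` requires that there are none.
    · have key : sem w (seq (choose T v) (nlook (qbfTest T cs qs))) (0, boolAsg T σ) =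
          {c | ∃ b, ¬ QBF.Holds cs qs (Function.update σ v b) ∧
            c = (0, boolAsg T (Function.update σ v b))} := by
        ext c
        simp only [sem, sem_choose hw, ← (ih _).1, Set.not_nonempty_iff_eq_empty]
        simp
      rw [qbfTest, sem.eq_9, key]
      refine ⟨?_, by simp +contextual⟩
      have h0 : {c : ℕ × (List Bool → List A) | ∃ b, ¬ QBF.Holds cs qs (Function.update σ v b) ∧
          c = (0, boolAsg T (Function.update σ v b))} = ∅ ↔
          ∀ b, QBF.Holds cs qs (Function.update σ v b) := by
        rw [Set.eq_empty_iff_forall_notMem]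
        exact ⟨fun h b => by_contra fun hb => h _ ⟨b, hb, rfl⟩, fun h c ⟨b, hb, _⟩ => hb (h b)⟩
      rw [QBF.Holds, ← h0]
      exact ⟨fun ⟨c, hc⟩ => hc.1, fun h => ⟨_, h, rfl⟩⟩
    · have key : sem w (qbfTest T cs ((true, v) :: qs)) (0, boolAsg T σ) =
          {c | ∃ b, c ∈ sem w (qbfTest T cs qs) (0, boolAsg T (Function.update σ v b))} := by
        ext c
        simp only [qbfTest, sem, sem_choose hw]
        simp
      rw [key]
      refine ⟨?_, ?_⟩
      · simp only [QBF.Holds, ← (ih _).1, Set.Nonempty, Set.mem_ofPred_eq]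
        exact exists_comm
      · rintro c ⟨b, hc⟩
        exact (ih _).2 c hc

end

/-- Consume letters `T` and `F`. -/
def skipLetters (T F : A) : REWBLk A V := star (alt (sym T) (sym F))

theorem mem_sem_skipLetters {T F : A} {w : List A} (hw : ∀ x ∈ w, x = T ∨ x = F)
    (Λ : V → List A) : (w.length, Λ) ∈ sem w (skipLetters T F) (0, Λ) := by
  have key (i p : ℕ) (h : p + i = w.length) :
      (w.length, Λ) ∈ iter (sem w (alt (sym T) (sym F))) i (p, Λ) := by
    induction i generalizing p with
    | zero => simp [iter, ← h]
    | succ i ih =>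
      refine Set.mem_biUnion (x := (p + 1, Λ)) ?_ (ih (p + 1) (by omega))
      have hp : p < w.length := by omega
      rcases hw w[p] (List.getElem_mem hp) with h1 | h1
      · exact Or.inl ⟨by simp [hp, ← h1], rfl⟩
      · exact Or.inr ⟨by simp [hp, ← h1], rfl⟩
  exact Set.mem_iUnion.2 ⟨w.length, key _ 0 (by simp)⟩

/-- The expression of a quantified Boolean formula. -/
def ofQBF (T F : A) (Q : QBF) : REWBLk A (List Bool) :=
  seq (qbfTest T Q.clauses Q.quants) (skipLetters T F)

theorem mem_tfWord {T F x : A} {n m : ℕ} (h : x ∈ tfWord T F n m) : x = T ∨ x = F := by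
  simp only [tfWord, List.mem_append, List.mem_flatten, List.mem_replicate] at h
  rcases h with ⟨l, ⟨_, rfl⟩, h⟩ | ⟨_, rfl⟩
  · simpa using h
  · exact Or.inl rfl

theorem startsOnce_tfWord {T F : A} (hTF : T ≠ F) {n : ℕ} (hn : n ≠ 0) (m : ℕ) :
    StartsOnce T (tfWord T F n m) := by
  obtain ⟨n, rfl⟩ := Nat.exists_eq_succ_of_ne_zero hn
  exact ⟨F :: tfWord T F n m, by simp [tfWord, List.replicate_succ], by simpa using hTF.symm⟩

theorem isTrue_iff_mem_language {T F : A} (hTF : T ≠ F) (Q : QBF) :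
    Q.IsTrue ↔ tfWord T F Q.quants.length Q.clauses.length ∈ (ofQBF T F Q).language := by
  set w := tfWord T F Q.quants.length Q.clauses.length with hw
  have hq : Q.quants ≠ [] → StartsOnce T w := fun h =>
    startsOnce_tfWord hTF (by simpa using h) _
  -- A literal in a clause has a quantified variable because the formula is closed, so there is at
  -- least one block `TF`.
  have hc : ∀ C ∈ Q.clauses, C ≠ [] → StartsOnce T w := by
    intro C hC h
    obtain ⟨l, hl⟩ := List.exists_mem_of_ne_nil C h
    obtain ⟨q, hq', _⟩ := Q.closed C hC l hl
    exact hq (List.ne_nil_of_mem hq')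
  have h := sem_qbfTest hc hq (fun _ => false)
  rw [QBF.IsTrue, ← h.1]
  have h0 : (fun _ => [] : List Bool → List A) = boolAsg T (fun _ => false) := by
    funext v
    simp [boolAsg]
  constructor
  · rintro ⟨⟨p, Λ⟩, hp⟩
    obtain rfl : p = 0 := h.2 _ hp
    refine ⟨Λ, ?_⟩
    rw [h0]
    exact Set.mem_biUnion hp (mem_sem_skipLetters (fun x hx => mem_tfWord hx) Λ)
  · rintro ⟨Λ, hΛ⟩
    rw [h0] at hΛ
    obtain ⟨c, hc, _⟩ := Set.mem_iUnion₂.1 hΛ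
    exact ⟨c, hc⟩

end REWBLk

/-! ### Printing the expression of a quantified Boolean formula -/

instance {A : Type} [Finite A] : Finite (REWBLk.Token A) :=
  Finite.of_surjective
    (fun o : (A ⊕ Bool) ⊕ Fin 9 => match o with
      | Sum.inl (Sum.inl a) => REWBLk.Token.sym a
      | Sum.inl (Sum.inr b) => REWBLk.Token.bit b
      | Sum.inr i => ([.eps, .alt, .seq, .star, .capture, .backref, .look, .nlook, .sep] :
          List (REWBLk.Token A)).get i)
    (fun t => match t with
      | .sym a => ⟨Sum.inl (Sum.inl a), rfl⟩
      | .bit b => ⟨Sum.inl (Sum.inr b), rfl⟩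
      | .eps => ⟨Sum.inr 0, rfl⟩
      | .alt => ⟨Sum.inr 1, rfl⟩
      | .seq => ⟨Sum.inr 2, rfl⟩
      | .star => ⟨Sum.inr 3, rfl⟩
      | .capture => ⟨Sum.inr 4, rfl⟩
      | .backref => ⟨Sum.inr 5, rfl⟩
      | .look => ⟨Sum.inr 6, rfl⟩
      | .nlook => ⟨Sum.inr 7, rfl⟩
      | .sep => ⟨Sum.inr 8, rfl⟩)

instance : Finite QBF.Token :=
  Finite.of_surjective
    (fun o : (Bool × Fin 3) ⊕ Fin 2 => match o with
      | Sum.inl (b, i) => ([.quant b, .lit b, .bit b] : List QBF.Token).get i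
      | Sum.inr i => ([.clause, .sep] : List QBF.Token).get i)
    (fun t => match t with
      | .quant b => ⟨Sum.inl (b, 0), rfl⟩
      | .lit b => ⟨Sum.inl (b, 1), rfl⟩
      | .bit b => ⟨Sum.inl (b, 2), rfl⟩
      | .clause => ⟨Sum.inr 0, rfl⟩
      | .sep => ⟨Sum.inr 1, rfl⟩)

namespace QBFPrinter

open StackProg REWBLk

variable {A : Type}

/-- Programs that read formulas and write expressions. -/
abbrev Prog (A : Type) : Type := StackProg (Sym QBF.Token (REWBLk.Token A))

/-- The tokens written for a quantifier. -/
def quantTokens (T : A) (q : Bool × List Bool) : List (REWBLk.Token A) :=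
  (if q.1 then [.seq, .look, .capture] else [.nlook, .seq, .look, .capture]) ++
    (REWBLk.encodeName A q.2 ++ (if q.1 then [.alt, .sym T, .eps] else [.alt, .sym T, .eps, .nlook]))

/-- The tokens written for a literal. -/
def litTokens (T : A) (l : Bool × List Bool) : List (REWBLk.Token A) :=
  [.alt, if l.1 then .nlook else .look, .seq, .backref] ++ (REWBLk.encodeName A l.2 ++ [.sym T])

/-- The tokens that end the clause number `m`; there is no clause number `0`. -/
def closing (A : Type) (m : ℕ) : List (REWBLk.Token A) := if m = 0 then [] else [.nlook, .eps]

/-- The tokens written for a list of clauses, when `m` clauses have been written before. -/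
def clausesTokens (T : A) : ℕ → List (List (Bool × List Bool)) → List (REWBLk.Token A)
  | _, [] => []
  | m, C :: cs => closing A m ++ (.seq :: (C.flatMap (litTokens T) ++ clausesTokens T (m + 1) cs))

theorem encode_clauseTest (T : A) (C : List (Bool × List Bool)) :
    REWBLk.encode (clauseTest T C) = C.flatMap (litTokens T) ++ [.nlook, .eps] := by
  induction C with
  | nil => rfl
  | cons l C ih =>
    obtain ⟨_ | _, v⟩ := l <;>
    simp [clauseTest, litTest, REWBLk.encode, ih, litTokens]

/-- A reader of tokens learns that a clause has ended only at the next clause symbol or at the end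
of the input. The printed list therefore lags behind by one terminator, and `m = 0` marks that no
clause is open yet. -/
theorem encode_cnfTest (T : A) (cs : List (List (Bool × List Bool))) (m : ℕ) :
    clausesTokens T m cs ++ (closing A (m + cs.length) ++ [.eps]) =
      closing A m ++ REWBLk.encode (cnfTest T cs) := by
  induction cs generalizing m with
  | nil => rfl
  | cons C cs ih =>
    have h := ih (m + 1)
    rw [show m + 1 + cs.length = m + (C :: cs).length by simp; omega] at h
    simp only [clausesTokens, cnfTest, REWBLk.encode, encode_clauseTest, List.append_assoc,
      List.cons_append, h]
    simp [closing]

/-- In prefix notation a quantifier contributes only tokens in front of the rest and nothing after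
it, so the prefix is printed without a memory of the quantifiers. -/
theorem encode_qbfTest (T : A) (cs : List (List (Bool × List Bool))) (qs : List (Bool × List Bool)) :
    REWBLk.encode (qbfTest T cs qs) =
      qs.flatMap (quantTokens T) ++ REWBLk.encode (cnfTest T cs) := by
  induction qs with
  | nil => rfl
  | cons q qs ih =>
    obtain ⟨_ | _, v⟩ := q <;>
    simp [qbfTest, choose, REWBLk.encode, ih, quantTokens]

/-- The stacks in use. -/
def store (i : List QBF.Token) (r : List (REWBLk.Token A)) (a b : ℕ) :
    Store QBF.Token (REWBLk.Token A) :=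
  ⟨i, [], r, [], 0, 0, 0, a, b, 0⟩

/-- Is this the end of a name? -/
def isSep : QBF.Token → Bool
  | .sep => true
  | _ => false

/-- Copy a symbol of a name. -/
def copyBit : QBF.Token → Prog A
  | .bit b => put (.bit b)
  | _ => skip

/-- Copy a name. -/
def copyName : Prog A :=
  seq (loop (K := Stk) (Γ := Sym QBF.Token (REWBLk.Token A)) Stk.inp isSep copyBit) (put .sep)

/-- End a clause, if there is any. -/
def closeClause : Prog A :=
  pop (K := Stk) (Γ := Sym QBF.Token (REWBLk.Token A)) (Stk.ctr Ctr.b)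
    (fun o => o.elim skip (fun _ => seq (inc Ctr.b) (emit [.nlook, .eps])))

/-- Treat a token. -/
def body (T : A) : QBF.Token → Prog A
  | .quant q =>
      seq (emit (if q then [.seq, .look, .capture] else [.nlook, .seq, .look, .capture]))
        (seq copyName (seq
          (emit (if q then [.alt, .sym T, .eps] else [.alt, .sym T, .eps, .nlook])) (inc Ctr.a)))
  | .lit l =>
      seq (emit [.alt, if l then .nlook else .look, .seq, .backref]) (seq copyName (emit [.sym T]))
  | .clause => seq closeClause (seq (inc Ctr.b) (emit [.seq]))
  | _ => skip

/-- Print the code of the expression and the word of a formula. -/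
def prog (T F : A) : Prog A :=
  seq (emit [.seq]) <| seq (forInp (body T)) <| seq closeClause <|
    seq (emit [.eps, .star, .alt, .sym T, .sym F, .sep]) <|
    seq (forCtr Ctr.a (emit [.sym T, .sym F])) <|
    seq (forCtr Ctr.b (emit [.sym T])) finish

variable (T F : A)

theorem runs_copyName (v : List Bool) (i : List QBF.Token) (r : List (REWBLk.Token A)) (a b : ℕ) :
    Runs copyName (store (QBF.encodeName v ++ i) r a b)
      (store i ((REWBLk.encodeName A v).reverse ++ r) a b) (2 * v.length + 2) := by
  have h : Runs (loop (K := Stk) (Γ := Sym QBF.Token (REWBLk.Token A)) Stk.inp isSep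
      copyBit) (store (QBF.encodeName v ++ i) r a b)
      (store i ((v.map REWBLk.Token.bit).reverse ++ r) a b) (2 * v.length + 1) := by
    induction v generalizing r with
    | nil => exact Runs.loopInp_break rfl rfl
    | cons c v ih =>
      have h1 := Runs.loopInp_cons (brk := isSep) (f := copyBit) (x := QBF.Token.bit c)
        (s := store (QBF.encodeName (c :: v) ++ i) r a b) rfl rfl
        (Runs.put (REWBLk.Token.bit c)) (ih (.bit c :: r))
      rw [List.map_cons, List.reverse_cons, List.append_assoc, List.singleton_append]
      exact h1.mono (by rw [List.length_cons]; omega)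
  have h' := h.seq (Runs.put (REWBLk.Token.sep (A := A)))
  rw [REWBLk.encodeName, List.reverse_append]
  exact h'

/-- A counter is tested by popping it; the unit removed is put back when the counter was positive.
-/
theorem runs_closeClause (i : List QBF.Token) (r : List (REWBLk.Token A)) (a b : ℕ) :
    Runs closeClause (store i r a b) (store i ((closing A b).reverse ++ r) a b) 5 := by
  cases b with
  | zero => exact Runs.mono (Runs.popCtr_zero Ctr.b rfl Exec.skip) (by norm_num)
  | succ b =>
    exact Runs.popCtr_succ Ctr.b (m := b) rfl ((Runs.inc Ctr.b).seq (Runs.emit _))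

/-- Written with a continuation: a run of the remaining loop is prolonged to the front by one
quantifier. The price is 10 steps per input token, which leaves slack for the fixed words around the
name. -/
theorem runs_quant (q : Bool × List Bool) {i : List QBF.Token} {r : List (REWBLk.Token A)}
    {a b t : ℕ} {s : Store QBF.Token (REWBLk.Token A)}
    (h : Runs (forInp (body T)) (store i ((quantTokens T q).reverse ++ r) (a + 1) b) s t) :
    Runs (forInp (body T)) (store (.quant q.1 :: QBF.encodeName q.2 ++ i) r a b) s
      (10 * (QBF.Token.quant q.1 :: QBF.encodeName q.2).length + t) := by
  obtain ⟨q, v⟩ := q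
  have h1 : Runs (body T (.quant q)) (store (QBF.encodeName v ++ i) r a b)
      (store i ((quantTokens T (q, v)).reverse ++ r) (a + 1) b) (5 + (2 * v.length + 2 + (5 + 1))) := by
    have h2 := ((Runs.emit (s := store (QBF.encodeName v ++ i) r a b)
      (if q then [.seq, .look, .capture] else [.nlook, .seq, .look, .capture])).mono
        (t' := 5) (by cases q <;> simp)).seq ((runs_copyName v i _ a b).seq
      (((Runs.emit (if q then [.alt, .sym T, .eps] else [.alt, .sym T, .eps, .nlook])).mono
        (t' := 5) (by cases q <;> simp)).seq (Runs.inc Ctr.a)))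
    simp only [quantTokens, List.reverse_append, List.append_assoc]
    exact h2
  refine (Runs.loopInp_cons (x := QBF.Token.quant q) rfl rfl h1 h).mono ?_
  simp [QBF.encodeName]
  omega

theorem runs_lit (l : Bool × List Bool) {i : List QBF.Token} {r : List (REWBLk.Token A)}
    {a b t : ℕ} {s : Store QBF.Token (REWBLk.Token A)}
    (h : Runs (forInp (body T)) (store i ((litTokens T l).reverse ++ r) a b) s t) :
    Runs (forInp (body T)) (store (.lit l.1 :: QBF.encodeName l.2 ++ i) r a b) s
      (10 * (QBF.Token.lit l.1 :: QBF.encodeName l.2).length + t) := by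
  obtain ⟨q, v⟩ := l
  have h1 : Runs (body T (.lit q)) (store (QBF.encodeName v ++ i) r a b)
      (store i ((litTokens T (q, v)).reverse ++ r) a b) (5 + (2 * v.length + 2 + 2)) := by
    have h2 := (Runs.emit (s := store (QBF.encodeName v ++ i) r a b)
      [.alt, if q then .nlook else .look, .seq, .backref]).seq ((runs_copyName v i _ a b).seq
      (Runs.emit [REWBLk.Token.sym T]))
    simp only [litTokens, List.reverse_append, List.append_assoc]
    exact h2
  refine (Runs.loopInp_cons (x := QBF.Token.lit q) rfl rfl h1 h).mono ?_
  simp [QBF.encodeName]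
  omega

theorem runs_clause {i : List QBF.Token} {r : List (REWBLk.Token A)}
    {a b t : ℕ} {s : Store QBF.Token (REWBLk.Token A)}
    (h : Runs (forInp (body T)) (store i (.seq :: ((closing A b).reverse ++ r)) a (b + 1)) s t) :
    Runs (forInp (body T)) (store (.clause :: i) r a b) s (10 + t) := by
  have h1 : Runs (body T .clause) (store i r a b)
      (store i (.seq :: ((closing A b).reverse ++ r)) a (b + 1)) 8 :=
    (runs_closeClause i r a b).seq ((Runs.inc Ctr.b).seq (Runs.emit [REWBLk.Token.seq]))
  exact (Runs.loopInp_cons (s := store (.clause :: i) r a b) (brk := fun _ => false)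
    (f := body T) (x := QBF.Token.clause) rfl rfl h1 h).mono (by omega)

theorem runs_lits (C : List (Bool × List Bool)) {i : List QBF.Token} {r : List (REWBLk.Token A)}
    {a b t : ℕ} {s : Store QBF.Token (REWBLk.Token A)}
    (h : Runs (forInp (body T)) (store i ((C.flatMap (litTokens T)).reverse ++ r) a b) s t) :
    Runs (forInp (body T))
      (store (C.flatMap (fun l => QBF.Token.lit l.1 :: QBF.encodeName l.2) ++ i) r a b) s
      (10 * (C.flatMap (fun l => QBF.Token.lit l.1 :: QBF.encodeName l.2)).length + t) := by
  induction C generalizing r with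
  | nil => simpa using h
  | cons l C ih =>
    rw [List.flatMap_cons, List.reverse_append, List.append_assoc] at h
    have h1 := runs_lit T l (ih h)
    rw [List.flatMap_cons, List.append_assoc, List.length_append]
    exact h1.mono (by omega)

theorem runs_clauses (cs : List (List (Bool × List Bool))) (r : List (REWBLk.Token A)) (a b : ℕ) :
    Runs (forInp (body T)) (store (cs.flatMap (fun C => QBF.Token.clause ::
        C.flatMap (fun l => QBF.Token.lit l.1 :: QBF.encodeName l.2))) r a b)
      (store [] ((clausesTokens T b cs).reverse ++ r) a (b + cs.length))
      (10 * (cs.flatMap (fun C => QBF.Token.clause ::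
        C.flatMap (fun l => QBF.Token.lit l.1 :: QBF.encodeName l.2))).length + 1) := by
  induction cs generalizing r b with
  | nil => exact Runs.loopInp_nil rfl
  | cons C cs ih =>
    have h1 := runs_clause (b := b) (r := r) T (runs_lits T C (ih _ _))
    have e : (clausesTokens T (b + 1) cs).reverse ++ ((C.flatMap (litTokens T)).reverse ++
        (.seq :: ((closing A b).reverse ++ r))) = (clausesTokens T b (C :: cs)).reverse ++ r := by
      simp [clausesTokens]
    rw [e, show b + 1 + cs.length = b + (C :: cs).length by simp; omega] at h1
    rw [List.flatMap_cons, List.cons_append]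
    exact h1.mono (by rw [List.length_cons (as := _ ++ _), List.length_append]; omega)

theorem runs_formula (cs : List (List (Bool × List Bool))) (qs : List (Bool × List Bool))
    (r : List (REWBLk.Token A)) (a : ℕ) :
    Runs (forInp (body T)) (store
        (qs.flatMap (fun q => QBF.Token.quant q.1 :: QBF.encodeName q.2) ++
          cs.flatMap (fun C => QBF.Token.clause ::
            C.flatMap (fun l => QBF.Token.lit l.1 :: QBF.encodeName l.2))) r a 0)
      (store [] ((clausesTokens T 0 cs).reverse ++ ((qs.flatMap (quantTokens T)).reverse ++ r))
        (a + qs.length) cs.length)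
      (10 * (qs.flatMap (fun q => QBF.Token.quant q.1 :: QBF.encodeName q.2) ++
          cs.flatMap (fun C => QBF.Token.clause ::
            C.flatMap (fun l => QBF.Token.lit l.1 :: QBF.encodeName l.2))).length + 1) := by
  induction qs generalizing r a with
  | nil => simpa using runs_clauses T cs r a 0
  | cons q qs ih =>
    have h1 := runs_quant T q (r := r) (a := a) (ih _ (a + 1))
    rw [show a + 1 + qs.length = a + (q :: qs).length by simp; omega] at h1
    rw [List.flatMap_cons, List.flatMap_cons, List.reverse_append, List.append_assoc,
      List.append_assoc, List.length_append]
    exact h1.mono (by omega)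

theorem length_flatMap_le {X Y Z : Type} {f : X → List Y} {g : X → List Z} {c : ℕ}
    (h : ∀ x, (f x).length ≤ c * (g x).length) (l : List X) :
    (l.flatMap f).length ≤ c * (l.flatMap g).length := by
  induction l with
  | nil => simp
  | cons x l ih =>
    rw [List.flatMap_cons, List.flatMap_cons, List.length_append, List.length_append, mul_add]
    exact Nat.add_le_add (h x) ih

theorem length_quants_le (Q : QBF) :
    Q.quants.length + Q.clauses.length ≤ Q.encode.length := by
  rw [QBF.encode, List.length_append]
  have h1 := length_flatMap_le (c := 1) (f := fun q : Bool × List Bool => [q])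
    (g := fun q => QBF.Token.quant q.1 :: QBF.encodeName q.2) (by simp) Q.quants
  have h2 := length_flatMap_le (c := 1) (f := fun C : List (Bool × List Bool) => [C])
    (g := fun C => QBF.Token.clause ::
      C.flatMap (fun l => QBF.Token.lit l.1 :: QBF.encodeName l.2)) (by simp) Q.clauses
  simp only [List.flatMap_singleton', one_mul] at h1 h2
  exact Nat.add_le_add h1 h2

/-- Needed for the time of `finish`, which reverses everything that has been written. -/
theorem length_encode_le (Q : QBF) :
    (REWBLk.encode (qbfTest T Q.clauses Q.quants)).length ≤ 5 * Q.encode.length + 1 := by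
  rw [encode_qbfTest, QBF.encode, List.length_append, List.length_append]
  have h1 := length_flatMap_le (c := 5) (f := quantTokens T)
    (g := fun q => QBF.Token.quant q.1 :: QBF.encodeName q.2) (by
      rintro ⟨_ | _, v⟩ <;> simp [quantTokens, QBF.encodeName, REWBLk.encodeName] <;> omega) Q.quants
  have h2 := length_flatMap_le (c := 5) (f := fun C => .seq :: (C.flatMap (litTokens T) ++
      [.nlook, .eps]))
    (g := fun C => QBF.Token.clause ::
      C.flatMap (fun l => QBF.Token.lit l.1 :: QBF.encodeName l.2)) (by
      intro C
      have h3 := length_flatMap_le (c := 5) (f := litTokens T)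
        (g := fun l => QBF.Token.lit l.1 :: QBF.encodeName l.2) (by
        rintro ⟨_ | _, v⟩ <;> simp [litTokens, QBF.encodeName, REWBLk.encodeName] <;> omega) C
      rw [List.length_cons, List.length_cons, List.length_append]
      simp only [List.length_cons, List.length_nil]
      omega) Q.clauses
  have h4 : REWBLk.encode (cnfTest T Q.clauses) = Q.clauses.flatMap (fun C => .seq ::
      (C.flatMap (litTokens T) ++ [.nlook, .eps])) ++ [.eps] := by
    generalize Q.clauses = cs
    induction cs with
    | nil => rfl
    | cons C cs ih => simp [cnfTest, REWBLk.encode, encode_clauseTest, ih]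
  rw [h4, List.length_append, List.length_singleton]
  omega

theorem encodeInstance_ofQBF (Q : QBF) :
    REWBLk.encodeInstance (ofQBF T F Q, tfWord T F Q.quants.length Q.clauses.length) =
      .seq :: (REWBLk.encode (qbfTest T Q.clauses Q.quants) ++
        ([.star, .alt, .sym T, .sym F, .sep] ++
          ((List.replicate Q.quants.length [REWBLk.Token.sym T, .sym F]).flatten ++
            (List.replicate Q.clauses.length [REWBLk.Token.sym T]).flatten))) := by
  simp [REWBLk.encodeInstance, ofQBF, REWBLk.encode, skipLetters, tfWord]

theorem runs_forCtr_a (l r : List (REWBLk.Token A)) (n m : ℕ) :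
    Runs (forCtr Ctr.a (emit l)) (store [] r n m)
      (store [] ((List.replicate n l).flatten.reverse ++ r) 0 m) (n * (l.length + 2) + 1) := by
  refine Runs.forCtr Ctr.a
    (fun a d => store [] ((List.replicate d l).flatten.reverse ++ r) a m) (l.length + 1)
    (fun _ _ => rfl) (fun a d => ?_) n
  have h := Runs.emit (s := store [] ((List.replicate d l).flatten.reverse ++ r) a m) l
  rw [List.replicate_succ', List.flatten_append, List.reverse_append, List.append_assoc,
    List.flatten_singleton]
  exact h

theorem runs_forCtr_b (l r : List (REWBLk.Token A)) (m : ℕ) :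
    Runs (forCtr Ctr.b (emit l)) (store [] r 0 m)
      (store [] ((List.replicate m l).flatten.reverse ++ r) 0 0) (m * (l.length + 2) + 1) := by
  refine Runs.forCtr Ctr.b
    (fun a d => store [] ((List.replicate d l).flatten.reverse ++ r) 0 a) (l.length + 1)
    (fun _ _ => rfl) (fun a d => ?_) m
  have h := Runs.emit (s := store [] ((List.replicate d l).flatten.reverse ++ r) 0 a) l
  rw [List.replicate_succ', List.flatten_append, List.reverse_append, List.append_assoc,
    List.flatten_singleton]
  exact h

theorem runs_prog (Q : QBF) :
    Runs (prog T F) (Store.ofInp Q.encode) (Store.ofOut (REWBLk.encodeInstance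
      (ofQBF T F Q, tfWord T F Q.quants.length Q.clauses.length)))
      (100 * Q.encode.length + 100) := by
  have h := (Runs.emit (s := store Q.encode [] 0 0) [REWBLk.Token.seq (A := A)]).seq <|
    (runs_formula T Q.clauses Q.quants _ 0).seq <| (runs_closeClause _ _ _ _).seq <|
    (Runs.emit [.eps, .star, .alt, .sym T, .sym F, .sep]).seq <|
    (runs_forCtr_a [.sym T, .sym F] _ _ _).seq <|
    (runs_forCtr_b [.sym T] _ _).seq (Runs.finish _ _ _ _ _ _ _ _ _ _)
  have hl := length_quants_le Q
  have he := length_encode_le T Q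
  have hc := encode_cnfTest T Q.clauses 0
  rw [zero_add] at hc h
  -- `closing A 0` is empty by computation.
  change _ = REWBLk.encode _ at hc
  have e : Store.ofOut (REWBLk.encodeInstance
      (ofQBF T F Q, tfWord T F Q.quants.length Q.clauses.length)) = Store.mk (α := QBF.Token) [] [] []
      (List.reverse ((List.replicate Q.clauses.length [REWBLk.Token.sym T]).flatten.reverse ++
      ((List.replicate Q.quants.length [REWBLk.Token.sym T, .sym F]).flatten.reverse ++
      ([REWBLk.Token.eps, .star, .alt, .sym T, .sym F, .sep].reverse ++
      ((closing A Q.clauses.length).reverse ++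
      ((clausesTokens T 0 Q.clauses).reverse ++ ((Q.quants.flatMap (quantTokens T)).reverse ++
        ([REWBLk.Token.seq].reverse ++ []))))))) ++ []) 0 0 0 0 0 0 := by
    rw [encodeInstance_ofQBF, encode_qbfTest, ← hc]
    simp [Store.ofOut]
  rw [e]
  refine Runs.mono h ?_
  rw [encode_qbfTest, ← hc] at he
  simp only [List.length_append, List.length_reverse, List.length_cons, List.length_nil,
    List.length_flatten, List.map_replicate, List.sum_replicate, smul_eq_mul, store] at he ⊢
  have hq : (Q.quants.flatMap (fun q => QBF.Token.quant q.1 :: QBF.encodeName q.2)).length +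
      (Q.clauses.flatMap (fun C => QBF.Token.clause ::
        C.flatMap (fun l => QBF.Token.lit l.1 :: QBF.encodeName l.2))).length =
      Q.encode.length := by rw [QBF.encode, List.length_append]
  omega

theorem polyTime [Finite A] :
    PolyTime QBF.encode REWBLk.encodeInstance
      (fun Q : QBF => (ofQBF T F Q, tfWord T F Q.quants.length Q.clauses.length)) := by
  refine polyTime_of_runs (prog T F) (Polynomial.C 100 * Polynomial.X + Polynomial.C 100)
    fun Q => ?_
  simpa using runs_prog T F Q

end QBFPrinter

/-! ### Expressions that compute with numbers stored in variables -/

namespace REWBLk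

variable {A V : Type} [DecidableEq V]

/-- Consume the word `u`. -/
def word : List A → REWBLk A V
  | [] => eps
  | a :: u => seq (sym a) (word u)

theorem sem_word (w u : List A) (c : ℕ × (V → List A)) :
    sem w (word u) c = {c' | u <+: w.drop c.1 ∧ c' = (c.1 + u.length, c.2)} := by
  induction u generalizing c with
  | nil => simp [word, sem]
  | cons a u ih =>
    obtain ⟨p, Λ⟩ := c
    have h1 : (a :: u) <+: w.drop p ↔ w[p]? = some a ∧ u <+: w.drop (p + 1) := by
      cases hp : w[p]? with
      | none =>
        have h : w.length ≤ p := List.getElem?_eq_none_iff.1 hp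
        simp [List.drop_eq_nil_of_le h]
      | some b =>
        obtain ⟨hl, rfl⟩ := List.getElem?_eq_some_iff.1 hp
        rw [List.drop_eq_getElem_cons hl, List.cons_prefix_cons]
        simp [eq_comm]
    ext c'
    rw [word, sem]
    simp only [Set.mem_iUnion, ih, Set.mem_ofPred_eq, h1, List.length_cons]
    constructor
    · rintro ⟨d, ⟨h, rfl⟩, h', rfl⟩
      exact ⟨⟨h, h'⟩, by simp; omega⟩
    · rintro ⟨⟨h, h'⟩, rfl⟩
      exact ⟨_, ⟨h, rfl⟩, h', by simp; omega⟩

/-- The word `T ⋯ T F`. -/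
def unaryWord (T F : A) (n : ℕ) : List A := List.replicate n T ++ [F]

/-- The assignment that stores numbers as words `T ⋯ T`. -/
def unaryAsg (T : A) (g : V → ℕ) (v : V) : List A := List.replicate (g v) T

theorem unaryAsg_update (T : A) (g : V → ℕ) (v : V) (j : ℕ) :
    unaryAsg T (Function.update g v j) =
      Function.update (unaryAsg T g) v (List.replicate j T) := by
  funext u
  by_cases h : u = v
  · subst h
    simp [unaryAsg]
  · simp [unaryAsg, h]

/-- On the word `T ⋯ T F` with `K` letters `T`, the expression `E` transforms numbers up to `K`
according to `R`, and leaves the position `0` unchanged. -/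
structure Acts (T F : A) (K : ℕ) (E : REWBLk A V) (R : (V → ℕ) → (V → ℕ) → Prop) : Prop where
  sem_eq : ∀ g, (∀ v, g v ≤ K) → sem (unaryWord T F K) E (0, unaryAsg T g) =
    {c | ∃ g', R g g' ∧ c = (0, unaryAsg T g')}
  bounded : ∀ g g', (∀ v, g v ≤ K) → R g g' → ∀ v, g' v ≤ K

namespace Acts

variable {T F : A} {K : ℕ} {E E' : REWBLk A V} {R R' : (V → ℕ) → (V → ℕ) → Prop}

theorem of_update {f : (V → ℕ) → ℕ} {v : V} (hf : ∀ g, (∀ v, g v ≤ K) → f g ≤ K)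
    (h : ∀ g, (∀ v, g v ≤ K) → sem (unaryWord T F K) E (0, unaryAsg T g) =
      {c | c = (0, unaryAsg T (Function.update g v (f g)))}) :
    Acts T F K E (fun g g' => g' = Function.update g v (f g)) where
  sem_eq g hg := by simp [h g hg]
  bounded g g' hg := by
    rintro rfl u
    by_cases hu : u = v
    · subst hu
      simpa using hf g hg
    · simpa [hu] using hg u

theorem congr (h : Acts T F K E R) (e : ∀ g g', R g g' ↔ R' g g') : Acts T F K E R' := by
  rwa [← show R = R' from funext fun g => funext fun g' => propext (e g g')]

theorem eps : Acts T F K (REWBLk.eps : REWBLk A V) (fun g g' => g' = g) where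
  sem_eq g hg := by simp [sem]
  bounded g g' hg := by
    rintro rfl
    exact hg

theorem fail : Acts T F K (nlook REWBLk.eps : REWBLk A V) (fun _ _ => False) where
  sem_eq g hg := by simp [sem]
  bounded g g' hg h := h.elim

/-- The field `bounded` serves here: it keeps the intermediate numbers within `K`, so that `sem_eq`
of the second expression applies. -/
theorem seq (h : Acts T F K E R) (h' : Acts T F K E' R') :
    Acts T F K (seq E E') (fun g g' => ∃ g₁, R g g₁ ∧ R' g₁ g') where
  sem_eq g hg := by
    ext c
    rw [sem, h.sem_eq g hg]
    simp only [Set.mem_iUnion, Set.mem_ofPred_eq]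
    constructor
    · rintro ⟨_, ⟨g₁, h1, rfl⟩, h2⟩
      rw [h'.sem_eq g₁ (h.bounded g g₁ hg h1)] at h2
      obtain ⟨g', h2, rfl⟩ := h2
      exact ⟨g', ⟨g₁, h1, h2⟩, rfl⟩
    · rintro ⟨g', ⟨g₁, h1, h2⟩, rfl⟩
      refine ⟨_, ⟨g₁, h1, rfl⟩, ?_⟩
      rw [h'.sem_eq g₁ (h.bounded g g₁ hg h1)]
      exact ⟨g', h2, rfl⟩
  bounded g g' hg := by
    rintro ⟨g₁, h1, h2⟩
    exact h'.bounded g₁ g' (h.bounded g g₁ hg h1) h2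

theorem alt (h : Acts T F K E R) (h' : Acts T F K E' R') :
    Acts T F K (alt E E') (fun g g' => R g g' ∨ R' g g') where
  sem_eq g hg := by
    ext c
    rw [sem, h.sem_eq g hg, h'.sem_eq g hg]
    simp only [Set.mem_union, Set.mem_ofPred_eq, or_and_right, exists_or]
  bounded g g' hg := by
    rintro (h1 | h1)
    · exact h.bounded g g' hg h1
    · exact h'.bounded g g' hg h1

theorem star (h : Acts T F K E R) : Acts T F K (star E) (Relation.ReflTransGen R) where
  sem_eq g hg := by
    ext c
    rw [sem]
    simp only [Set.mem_iUnion, Set.mem_ofPred_eq]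
    constructor
    · rintro ⟨i, hi⟩
      induction i generalizing g with
      | zero => exact ⟨g, .refl, hi⟩
      | succ i ih =>
        obtain ⟨d, hd, hi⟩ := Set.mem_iUnion₂.1 hi
        rw [h.sem_eq g hg] at hd
        obtain ⟨g₁, h1, rfl⟩ := hd
        obtain ⟨g', h2, rfl⟩ := ih g₁ (h.bounded g g₁ hg h1) hi
        exact ⟨g', .head h1 h2, rfl⟩
    · rintro ⟨g', hr, rfl⟩
      induction hr using Relation.ReflTransGen.head_induction_on with
      | refl => exact ⟨0, rfl⟩
      | head h1 _ ih =>
        obtain ⟨i, hi⟩ := ih (h.bounded _ _ hg h1)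
        refine ⟨i + 1, Set.mem_biUnion ?_ hi⟩
        rw [h.sem_eq _ hg]
        exact ⟨_, h1, rfl⟩
  bounded g g' hg hr := by
    induction hr with
    | refl => exact hg
    | tail _ h1 ih => exact h.bounded _ _ ih h1

end Acts

/-- Store the number `j` in `v`. -/
def setNum (T : A) (v : V) (j : ℕ) : REWBLk A V := look (capture (word (List.replicate j T)) v)

/-- Store the value of `v` in `u`. -/
def copyVar (u v : V) : REWBLk A V := look (capture (backref v) u)

/-- Test whether `v` has the value `j`, for numbers up to `K`. -/
def testNum (T F : A) (K : ℕ) (v : V) (j : ℕ) : REWBLk A V :=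
  look (seq (backref v) (word (unaryWord T F (K - j))))

section

variable {T F : A} {K : ℕ}

theorem replicate_isPrefix {j : ℕ} (hj : j ≤ K) :
    List.replicate j T <+: unaryWord T F K := by
  obtain ⟨i, rfl⟩ := Nat.exists_eq_add_of_le hj
  rw [unaryWord, List.replicate_add, List.append_assoc]
  exact List.prefix_append _ _

/-- The letter `F` acts as an end marker that makes the words `T^m F` prefix-free; the exactness of
`testNum` rests on this. -/
theorem unaryWord_isPrefix (hTF : T ≠ F) {m n : ℕ} :
    unaryWord T F m <+: unaryWord T F n ↔ m = n := by
  refine ⟨fun h => ?_, fun h => h ▸ List.prefix_rfl⟩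
  induction m generalizing n with
  | zero =>
    cases n with
    | zero => rfl
    | succ n =>
      rw [unaryWord, unaryWord, List.replicate_succ, List.cons_append] at h
      exact absurd (List.cons_prefix_cons.1 h).1 hTF.symm
  | succ m ih =>
    cases n with
    | zero =>
      rw [unaryWord, unaryWord, List.replicate_succ, List.cons_append] at h
      exact absurd (List.cons_prefix_cons.1 h).1 hTF
    | succ n =>
      rw [unaryWord, unaryWord, List.replicate_succ, List.replicate_succ, List.cons_append,
        List.cons_append] at h
      rw [ih (List.cons_prefix_cons.1 h).2]

theorem drop_unaryWord {p : ℕ} (hp : p ≤ K) :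
    (unaryWord T F K).drop p = unaryWord T F (K - p) := by
  rw [unaryWord, List.drop_append_of_le_length (by simpa using hp), List.drop_replicate]
  rfl

theorem acts_setNum (v : V) {j : ℕ} (hj : j ≤ K) :
    Acts T F K (setNum T v j) (fun g g' => g' = Function.update g v j) := by
  refine Acts.of_update (f := fun _ => j) (fun _ _ => hj) fun g hg => ?_
  have h := replicate_isPrefix (T := T) (F := F) hj
  ext c
  rw [setNum, sem, sem, sem_word]
  simp only [Set.mem_ofPred_eq, List.drop_zero, h, unaryAsg_update, true_and]
  have h1 := List.prefix_iff_eq_take.1 h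
  rw [List.length_replicate] at h1
  constructor
  · rintro ⟨_, ⟨_, rfl, rfl⟩, rfl⟩
    simp [← h1]
  · rintro rfl
    exact ⟨_, ⟨_, rfl, rfl⟩, by simp [← h1]⟩

/-- A backreference to a number up to `K` always matches at position `0`, where the word begins with
`T^K`, and the capture picks up the same word again. -/
theorem acts_copyVar (u v : V) :
    Acts T F K (copyVar u v) (fun g g' => g' = Function.update g u (g v)) := by
  refine Acts.of_update (f := fun g => g v) (fun g hg => hg v) fun g hg => ?_
  have h := replicate_isPrefix (T := T) (F := F) (hg v)
  have h1 := List.prefix_iff_eq_take.1 h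
  rw [List.length_replicate] at h1
  ext c
  rw [copyVar, sem, sem, sem]
  simp only [Set.mem_ofPred_eq, List.drop_zero, unaryAsg_update]
  constructor
  · rintro ⟨_, ⟨_, ⟨_, rfl⟩, rfl⟩, rfl⟩
    simp [unaryAsg, ← h1]
  · rintro rfl
    exact ⟨_, ⟨_, ⟨h, rfl⟩, rfl⟩, by simp [unaryAsg, ← h1]⟩

theorem acts_testNum (hTF : T ≠ F) (v : V) {j : ℕ} (hj : j ≤ K) :
    Acts T F K (testNum T F K v j) (fun g g' => g v = j ∧ g' = g) where
  sem_eq g hg := by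
    have h := replicate_isPrefix (T := T) (F := F) (hg v)
    -- Subtraction is truncated, so both `j ≤ K` and `g v ≤ K` are used.
    have h1 : K - j = K - g v ↔ g v = j := by
      have := hg v
      omega
    have h2 : unaryAsg T g v <+: unaryWord T F K := h
    have h3 : (unaryAsg T g v).length = g v := by simp [unaryAsg]
    ext c
    rw [testNum, sem, sem, sem]
    simp only [Set.mem_ofPred_eq, List.drop_zero, Set.mem_iUnion, sem_word, h2, true_and, h3,
      zero_add]
    constructor
    · rintro ⟨_, ⟨_, rfl, hd, rfl⟩, rfl⟩
      rw [drop_unaryWord (hg v), unaryWord_isPrefix hTF, h1] at hd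
      exact ⟨g, ⟨hd, rfl⟩, rfl⟩
    · rintro ⟨_, ⟨hd, rfl⟩, rfl⟩
      refine ⟨_, ⟨_, rfl, ?_, rfl⟩, rfl⟩
      rw [drop_unaryWord (hg v), unaryWord_isPrefix hTF, h1]
      exact hd
  bounded g g' hg := by
    rintro ⟨_, rfl⟩
    exact hg

end

end REWBLk

/-! ### Space-bounded computations as expressions -/

namespace REWBLk

variable {A : Type}

/-- The variable for the tape cell number `j`. -/
def cell (j : ℕ) : List Bool := List.replicate j true

/-- The variable for the state. -/
def stateVar : List Bool := [false]

/-- The variable for the scanned symbol. -/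
def symVar : List Bool := [false, false]

/-- The variable for the direction of the next move. -/
def dirVar : List Bool := [false, true]

theorem cell_inj {i j : ℕ} : cell i = cell j ↔ i = j := by
  refine ⟨fun h => ?_, fun h => h ▸ rfl⟩
  simpa [cell] using congrArg List.length h

/-- Cell names use the bit `true` only, while the three working variables contain `false`; this
keeps them apart. -/
theorem not_mem_cell {j : ℕ} : false ∉ cell j := by simp [cell]

theorem stateVar_ne_cell {j : ℕ} : stateVar ≠ cell j := fun h =>
  not_mem_cell (j := j) (h ▸ by simp [stateVar])

theorem symVar_ne_cell {j : ℕ} : symVar ≠ cell j := fun h =>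
  not_mem_cell (j := j) (h ▸ by simp [symVar])

theorem dirVar_ne_cell {j : ℕ} : dirVar ≠ cell j := fun h =>
  not_mem_cell (j := j) (h ▸ by simp [dirVar])

/-- Move the contents of the cells `a + 1, …, a + b` down by one. -/
def shiftDown : ℕ → ℕ → REWBLk A (List Bool)
  | _, 0 => eps
  | a, b + 1 => seq (copyVar (cell a) (cell (a + 1))) (shiftDown (a + 1) b)

/-- Move the contents of the cells `0, …, a - 1` up by one. -/
def shiftUp : ℕ → REWBLk A (List Bool)
  | 0 => eps
  | a + 1 => seq (copyVar (cell (a + 1)) (cell a)) (shiftUp a)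

/-- A row of a transition table: state, symbol, new state, new symbol, direction. -/
structure Row : Type where
  q : ℕ
  x : ℕ
  q' : ℕ
  x' : ℕ
  d : ℕ

/-- Apply one row of the transition table. -/
def rowExpr (T F : A) (K : ℕ) (r : Row) : REWBLk A (List Bool) :=
  seq (testNum T F K stateVar r.q) (seq (testNum T F K symVar r.x)
    (seq (setNum T stateVar r.q') (seq (setNum T symVar r.x') (setNum T dirVar r.d))))

/-- Apply the transition table. -/
def tableExpr (T F : A) (K : ℕ) : List Row → REWBLk A (List Bool)
  | [] => nlook eps
  | r :: rs => alt (rowExpr T F K r) (tableExpr T F K rs)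

/-- One step of the computation. The head is always on the cell number `H`, and there are cells
with the numbers `0, …, 2 * H`. -/
def stepExpr (T F : A) (K : ℕ) (rs : List Row) (H : ℕ) : REWBLk A (List Bool) :=
  seq (copyVar symVar (cell H)) (seq (tableExpr T F K rs) (seq (copyVar (cell H) symVar)
    (alt (seq (testNum T F K dirVar 0) (shiftUp (H + H)))
      (seq (testNum T F K dirVar 1) (shiftDown 0 (H + H))))))

/-- Store numbers in the cells from `j` on. -/
def inputExpr (T : A) : ℕ → List ℕ → REWBLk A (List Bool)
  | _, [] => eps
  | j, x :: l => seq (setNum T (cell j) x) (inputExpr T (j + 1) l)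

/-- The expression that simulates a computation. -/
def simExpr (T F : A) (K : ℕ) (rs : List Row) (q₀ q₁ : ℕ) (H : ℕ) (l : List ℕ) :
    REWBLk A (List Bool) :=
  seq (setNum T stateVar q₀) (seq (inputExpr T H l) (seq (star (stepExpr T F K rs H))
    (seq (testNum T F K stateVar q₁) (word (unaryWord T F K)))))

/-- The effect of a row of the transition table. -/
def Row.apply (r : Row) (g : List Bool → ℕ) : List Bool → ℕ :=
  Function.update (Function.update (Function.update g stateVar r.q') symVar r.x') dirVar r.d

/-- The effect of a step, when the row `r` applies. -/
structure StepRel (rs : List Row) (H : ℕ) (r : Row) (g g' : List Bool → ℕ) : Prop where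
  mem : r ∈ rs
  state : g stateVar = r.q
  sym : g (cell H) = r.x
  state' : g' stateVar = r.q'
  cell_up : r.d = 0 → ∀ j < H + H, g' (cell (j + 1)) = if j = H then r.x' else g (cell j)
  cell_down : r.d = 1 → ∀ j < H + H, g' (cell j) = if j + 1 = H then r.x' else g (cell (j + 1))

section

variable {T F : A} {K : ℕ}

/-- The copies go upwards, so every cell is read before it is overwritten. The relation itself is
left abstract: it is functional, and only the values needed later are recorded. Nothing is claimed
about the last cell `a + b`. -/
theorem acts_shiftDown (a b : ℕ) :
    ∃ R, Acts T F K (shiftDown a b) R ∧ ∀ g, ∃ g', R g g' ∧ (∀ g'', R g g'' → g'' = g') ∧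
      (∀ v, (∀ j, v ≠ cell j) → g' v = g v) ∧ (∀ j < a, g' (cell j) = g (cell j)) ∧
      (∀ j, a ≤ j → j < a + b → g' (cell j) = g (cell (j + 1))) := by
  induction b generalizing a with
  | zero =>
    exact ⟨_, Acts.eps, fun g => ⟨g, rfl, fun _ h => h, fun _ _ => rfl, fun _ _ => rfl,
      fun j h1 h2 => by omega⟩⟩
  | succ b ih =>
    obtain ⟨R, hR, h⟩ := ih (a + 1)
    refine ⟨_, (acts_copyVar _ _).seq hR, fun g => ?_⟩
    obtain ⟨g', h1, h2, h3, h4, h5⟩ := h (Function.update g (cell a) (g (cell (a + 1))))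
    refine ⟨g', ⟨_, rfl, h1⟩, ?_, fun v hv => ?_, fun j hj => ?_, fun j hj hj' => ?_⟩
    · rintro g'' ⟨_, rfl, h⟩
      exact h2 g'' h
    · rw [h3 v hv, Function.update_of_ne (hv a)]
    · rw [h4 j (by omega), Function.update_of_ne]
      rw [Ne, cell_inj]
      omega
    · rcases hj.eq_or_lt with rfl | hj
      · rw [h4 a (by omega), Function.update_self]
      · rw [h5 j hj (by omega), Function.update_of_ne]
        rw [Ne, cell_inj]
        omega

/-- Mirror image: the copies go downwards from the top cell, and nothing is claimed about cell `0`.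
-/
theorem acts_shiftUp (a : ℕ) :
    ∃ R, Acts T F K (shiftUp a) R ∧ ∀ g, ∃ g', R g g' ∧ (∀ g'', R g g'' → g'' = g') ∧
      (∀ v, (∀ j, v ≠ cell j) → g' v = g v) ∧ (∀ j > a, g' (cell j) = g (cell j)) ∧
      (∀ j < a, g' (cell (j + 1)) = g (cell j)) := by
  induction a with
  | zero =>
    exact ⟨_, Acts.eps, fun g => ⟨g, rfl, fun _ h => h, fun _ _ => rfl, fun _ _ => rfl,
      fun j h => by omega⟩⟩
  | succ a ih =>
    obtain ⟨R, hR, h⟩ := ih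
    refine ⟨_, (acts_copyVar _ _).seq hR, fun g => ?_⟩
    obtain ⟨g', h1, h2, h3, h4, h5⟩ := h (Function.update g (cell (a + 1)) (g (cell a)))
    refine ⟨g', ⟨_, rfl, h1⟩, ?_, fun v hv => ?_, fun j hj => ?_, fun j hj => ?_⟩
    · rintro g'' ⟨_, rfl, h⟩
      exact h2 g'' h
    · rw [h3 v hv, Function.update_of_ne (hv _)]
    · rw [h4 j (by omega), Function.update_of_ne]
      rw [Ne, cell_inj]
      omega
    · rcases (Nat.lt_succ_iff.1 hj).eq_or_lt with rfl | hj
      · rw [h4 _ (by omega), Function.update_self]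
      · rw [h5 j hj, Function.update_of_ne]
        rw [Ne, cell_inj]
        omega

/-- All entries of a row are at most `K`. -/
structure Row.Bounded (K : ℕ) (r : Row) : Prop where
  q : r.q ≤ K
  x : r.x ≤ K
  q' : r.q' ≤ K
  x' : r.x' ≤ K
  d : r.d ≤ K

theorem acts_rowExpr (hTF : T ≠ F) {r : Row} (hr : r.Bounded K) :
    Acts T F K (rowExpr T F K r)
      (fun g g' => (g stateVar = r.q ∧ g symVar = r.x) ∧ g' = r.apply g) := by
  have h := (acts_testNum hTF stateVar hr.q).seq ((acts_testNum hTF symVar hr.x).seq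
    ((acts_setNum (F := F) stateVar hr.q').seq ((acts_setNum symVar hr.x').seq
      (acts_setNum dirVar hr.d))))
  refine h.congr fun g g' => ?_
  simp [Row.apply, and_assoc]

theorem acts_tableExpr (hTF : T ≠ F) {rs : List Row} (hrs : ∀ r ∈ rs, r.Bounded K) :
    Acts T F K (tableExpr T F K rs)
      (fun g g' => ∃ r ∈ rs, (g stateVar = r.q ∧ g symVar = r.x) ∧ g' = r.apply g) := by
  induction rs with
  | nil =>
    refine Acts.fail.congr fun g g' => ?_
    simp
  | cons r rs ih =>
    refine ((acts_rowExpr hTF (hrs r (by simp))).alt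
      (ih fun r hr => hrs r (by simp [hr]))).congr fun g g' => ?_
    rw [List.exists_mem_cons_iff]

/-- Cells outside the input keep their value. At the start this is `0`, the number of the blank, so
the empty part of the tape needs no initialisation. -/
theorem acts_inputExpr (j : ℕ) {l : List ℕ} (hl : ∀ x ∈ l, x ≤ K) :
    ∃ R, Acts T F K (inputExpr T j l) R ∧ ∀ g, ∃ g', R g g' ∧ (∀ g'', R g g'' → g'' = g') ∧
      (∀ v, (∀ j, v ≠ cell j) → g' v = g v) ∧
      (∀ i, g' (cell i) = if i < j then g (cell i) else (l[i - j]?).getD (g (cell i))) := by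
  induction l generalizing j with
  | nil => exact ⟨_, Acts.eps, fun g => ⟨g, rfl, fun _ h => h, fun _ _ => rfl, by simp⟩⟩
  | cons x l ih =>
    obtain ⟨R, hR, h⟩ := ih (j + 1) fun x hx => hl x (by simp [hx])
    refine ⟨_, (acts_setNum _ (hl x (by simp))).seq hR, fun g => ?_⟩
    obtain ⟨g', h1, h2, h3, h4⟩ := h (Function.update g (cell j) x)
    refine ⟨g', ⟨_, rfl, h1⟩, ?_, fun v hv => ?_, fun i => ?_⟩
    · rintro g'' ⟨_, rfl, h⟩
      exact h2 g'' h
    · rw [h3 v hv, Function.update_of_ne (hv _)]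
    · rw [h4]
      rcases lt_trichotomy i j with hi | rfl | hi
      · rw [if_pos (by omega), if_pos hi, Function.update_of_ne]
        rw [Ne, cell_inj]
        omega
      · simp
      · rw [if_neg (by omega), if_neg (by omega), Function.update_of_ne,
          show i - j = i - (j + 1) + 1 by omega, List.getElem?_cons_succ]
        rw [Ne, cell_inj]
        omega

/-- As the head stays on cell `H`, a move to the left (direction `0`) shifts the contents up and a
move to the right shifts them down. Two facts replace an explicit relation: every step comes from a
row of the table, and every applicable row gives a step. -/
theorem acts_stepExpr (hTF : T ≠ F) {rs : List Row} (hrs : ∀ r ∈ rs, r.Bounded K)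
    (hK : 1 ≤ K) (H : ℕ) :
    ∃ R, Acts T F K (stepExpr T F K rs H) R ∧
      (∀ g g', R g g' → ∃ r, StepRel rs H r g g') ∧
      (∀ g, ∀ r ∈ rs, g stateVar = r.q → g (cell H) = r.x → (r.d = 0 ∨ r.d = 1) → ∃ g', R g g') := by
  obtain ⟨Ru, hRu, hu⟩ := acts_shiftUp (T := T) (F := F) (K := K) (H + H)
  obtain ⟨Rd, hRd, hd⟩ := acts_shiftDown (T := T) (F := F) (K := K) 0 (H + H)
  have hs : stateVar ≠ symVar := by decide
  have hsd : stateVar ≠ dirVar := by decide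
  have hyd : symVar ≠ dirVar := by decide
  refine ⟨_, (acts_copyVar _ _).seq ((acts_tableExpr hTF hrs).seq ((acts_copyVar _ _).seq
    (((acts_testNum hTF dirVar (Nat.zero_le K)).seq hRu).alt
      ((acts_testNum hTF dirVar hK).seq hRd)))), ?_, ?_⟩
  · rintro g g' ⟨_, rfl, _, ⟨r, hr, ⟨hq, hx⟩, rfl⟩, _, rfl, h⟩
    rw [Function.update_of_ne hs] at hq
    rw [Function.update_self] at hx
    -- The numbers after the table has been applied and the new symbol written back to cell `H`,
    -- before the shift.
    set g₁ := Function.update (r.apply (Function.update g symVar (g (cell H)))) (cell H)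
      (r.apply (Function.update g symVar (g (cell H))) symVar) with hg₁
    have h1 : g₁ dirVar = r.d := by
      rw [hg₁, Function.update_of_ne dirVar_ne_cell, Row.apply, Function.update_self]
    have h2 : g₁ stateVar = r.q' := by
      rw [hg₁, Function.update_of_ne stateVar_ne_cell, Row.apply, Function.update_of_ne hsd,
        Function.update_of_ne hs, Function.update_self]
    have h3 (j : ℕ) : g₁ (cell j) = if j = H then r.x' else g (cell j) := by
      rw [hg₁]
      split_ifs with hj
      · rw [hj, Function.update_self, Row.apply, Function.update_of_ne hyd, Function.update_self]
      · rw [Function.update_of_ne (by rwa [Ne, cell_inj]), Row.apply,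
          Function.update_of_ne dirVar_ne_cell.symm, Function.update_of_ne symVar_ne_cell.symm,
          Function.update_of_ne stateVar_ne_cell.symm, Function.update_of_ne symVar_ne_cell.symm]
    refine ⟨r, ?_⟩
    rcases h with ⟨_, ⟨h0, rfl⟩, h⟩ | ⟨_, ⟨h0, rfl⟩, h⟩
    · obtain ⟨g₂, -, h4, h5, -, h6⟩ := hu g₁
      obtain rfl := h4 g' h
      rw [h1] at h0
      refine ⟨hr, hq, hx, ?_, fun _ j hj => ?_, fun h1 => by omega⟩
      · rw [h5 _ fun _ => stateVar_ne_cell, h2]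
      · rw [h6 j hj, h3]
    · obtain ⟨g₂, -, h4, h5, -, h6⟩ := hd g₁
      obtain rfl := h4 g' h
      rw [h1] at h0
      refine ⟨hr, hq, hx, ?_, fun h1 => by omega, fun _ j hj => ?_⟩
      · rw [h5 _ fun _ => stateVar_ne_cell, h2]
      · rw [h6 j (by omega) (by omega), h3]
  · intro g r hr hq hx hrd
    have h1 (g₀ : List Bool → ℕ) (m : ℕ) :
        Function.update (r.apply g₀) (cell H) m dirVar = r.d := by
      rw [Function.update_of_ne dirVar_ne_cell, Row.apply, Function.update_self]
    rcases hrd with h0 | h0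
    · obtain ⟨g₂, h2, -⟩ := hu _
      refine ⟨g₂, _, rfl, _, ⟨r, hr, ⟨?_, ?_⟩, rfl⟩, _, rfl, Or.inl ⟨_, ⟨?_, rfl⟩, h2⟩⟩
      · rwa [Function.update_of_ne hs]
      · rwa [Function.update_self]
      · rw [h1, h0]
    · obtain ⟨g₂, h2, -⟩ := hd _
      refine ⟨g₂, _, rfl, _, ⟨r, hr, ⟨?_, ?_⟩, rfl⟩, _, rfl, Or.inr ⟨_, ⟨?_, rfl⟩, h2⟩⟩
      · rwa [Function.update_of_ne hs]
      · rwa [Function.update_self]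
      · rw [h1, h0]

end

end REWBLk

/-! ### Turing machines as expressions -/

namespace DTM

open REWBLk

variable {α : Type} (M : DTM α)

variable {M} in
theorem step_unique {c c₁ c₂ : M.Cfg} (h₁ : M.Step c c₁) (h₂ : M.Step c c₂) : c₁ = c₂ := by
  obtain ⟨-, -, q, x, d, hd, h1, h2, h3⟩ := h₁
  obtain ⟨-, -, q', x', d', hd', h1', h2', h3'⟩ := h₂
  rw [hd] at hd'
  obtain ⟨rfl, rfl, rfl⟩ : q = q' ∧ x = x' ∧ d = d' := by simpa using hd'
  obtain ⟨s, p, t⟩ := c₁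
  obtain ⟨s', p', t'⟩ := c₂
  simp only at h1 h2 h3 h1' h2' h3'
  rw [h1, h2, h3, h1', h2', h3']

/-- A machine that decides a language reaches the accepting state exactly on its words. -/
theorem Decides.mem_iff {L : Language α} (h : M.Decides L) (w : List α) :
    w ∈ L ↔ ∃ c : M.Cfg, M.Reaches w c ∧ c.state = M.accept := by
  refine ⟨(h w).1, fun ⟨c, hc, hca⟩ => by_contra fun hw => ?_⟩
  obtain ⟨c', hc', hcr⟩ := (h w).2 hw
  rcases Relation.ReflTransGen.total_of_right_unique (fun _ _ _ => step_unique) hc hc' with h | h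
  · rcases Relation.ReflTransGen.cases_head h with rfl | ⟨d, hd, _⟩
    · exact M.accept_ne_reject (hca.symm.trans hcr)
    · exact hd.1 hca
  · rcases Relation.ReflTransGen.cases_head h with rfl | ⟨d, hd, _⟩
    · exact M.accept_ne_reject (hca.symm.trans hcr)
    · exact hd.2.1 hcr

/-- The head stays within the space bound. -/
theorem abs_head_le {w : List α} {s : ℕ} (hs : M.space w ≤ s) {c : M.Cfg} (hc : M.Reaches w c) :
    |c.head| ≤ s := by
  -- The head moves one cell at a time from `0`, so it has scanned every cell up to its present
  -- place; these `|c.head| + 1` cells are counted by the space.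
  have key : ∀ z ∈ Set.uIcc 0 c.head, ∃ c' : M.Cfg, M.Reaches w c' ∧ c'.head = z := by
    induction hc with
    | refl =>
      intro z hz
      refine ⟨M.initial w, .refl, ?_⟩
      simpa [DTM.initial, eq_comm] using hz
    | @tail c₁ c₂ h1 h2 ih =>
      intro z hz
      by_cases hz' : z = c₂.head
      · exact ⟨c₂, h1.tail h2, hz'.symm⟩
      · refine ih z ?_
        obtain ⟨-, -, q, x, d, -, -, -, h3⟩ := h2
        rw [Set.mem_uIcc] at hz ⊢
        cases d <;> simp only at h3 <;> omega
  have h1 : ((Set.uIcc 0 c.head).encard : ℕ∞) ≤ s := (Set.encard_le_encard key).trans hs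
  have h2 : (Finset.uIcc 0 c.head).card ≤ s := by
    rw [← Finset.coe_uIcc, Set.encard_coe_eq_coe_finsetCard] at h1
    exact_mod_cast h1
  rw [Int.card_uIcc] at h2
  rw [abs_le]
  constructor <;> omega

/-- An injective numbering of states and tape symbols by numbers up to `K`, the blank being `0`. -/
structure Numbering (K : ℕ) where
  state : M.Q → ℕ
  sym : M.Γ → ℕ
  state_inj : Function.Injective state
  sym_inj : Function.Injective sym
  state_le : ∀ q, state q ≤ K
  sym_le : ∀ x, sym x ≤ K
  sym_blank : sym M.blank = 0

theorem exists_numbering : ∃ K, 1 ≤ K ∧ Nonempty (M.Numbering K) := by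
  classical
  have := M.finite_Q
  have := M.finite_Γ
  obtain ⟨n, ⟨e⟩⟩ := Finite.exists_equiv_fin M.Q
  obtain ⟨m, ⟨f⟩⟩ := Finite.exists_equiv_fin M.Γ
  -- Nonblank symbols are shifted by one to reserve `0` for the blank; the summand `1` also leaves
  -- room for the direction `1`.
  refine ⟨n + m + 1, by omega, ⟨{
    state := fun q => e q
    sym := fun x => if x = M.blank then 0 else f x + 1
    state_inj := fun a b h => e.injective (Fin.ext h)
    sym_inj := fun a b h => ?_
    state_le := fun q => by have := (e q).2; omega
    sym_le := fun x => ?_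
    sym_blank := by simp }⟩⟩
  · by_cases ha : a = M.blank <;> by_cases hb : b = M.blank <;> simp [ha, hb] at h
    · rw [ha, hb]
    · exact f.injective (Fin.ext h)
  · have := (f x).2
    split_ifs <;> omega

/-- Directions as numbers. -/
def dirNum : Turing.Dir → ℕ
  | Turing.Dir.left => 0
  | Turing.Dir.right => 1

variable {M} {K : ℕ} (ν : M.Numbering K)

namespace Numbering

/-- The row of the transition table for a state and a symbol. -/
def row (z : M.Q × M.Γ) : Row where
  q := ν.state z.1
  x := ν.sym z.2
  q' := ν.state (M.δ z.1 z.2).1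
  x' := ν.sym (M.δ z.1 z.2).2.1
  d := dirNum (M.δ z.1 z.2).2.2

/-- The transition table, without the final states. -/
noncomputable def rows : List Row :=
  have := M.finite_Q
  have := M.finite_Γ
  (Set.toFinite {z : M.Q × M.Γ | z.1 ≠ M.accept ∧ z.1 ≠ M.reject}).toFinset.toList.map ν.row

theorem mem_rows {r : Row} :
    r ∈ ν.rows ↔ ∃ q x, q ≠ M.accept ∧ q ≠ M.reject ∧ r = ν.row (q, x) := by
  simp only [rows, List.mem_map, Finset.mem_toList, Set.Finite.mem_toFinset, Prod.exists,
    Set.mem_ofPred_eq]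
  exact ⟨fun ⟨q, x, h, h'⟩ => ⟨q, x, h.1, h.2, h'.symm⟩,
    fun ⟨q, x, h, h', h''⟩ => ⟨q, x, ⟨h, h'⟩, h''.symm⟩⟩

theorem bounded_rows (hK : 1 ≤ K) : ∀ r ∈ ν.rows, r.Bounded K := by
  intro r hr
  obtain ⟨q, x, -, -, rfl⟩ := ν.mem_rows.1 hr
  refine ⟨ν.state_le _, ν.sym_le _, ν.state_le _, ν.sym_le _, ?_⟩
  simp only [row]
  cases (M.δ q x).2.2
  · exact Nat.zero_le _
  · exact hK

/-- The numbers `g` describe the configuration `c`, as far as the cells at a distance of at most `s`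
from the origin are concerned. -/
structure Describes (s H : ℕ) (c : M.Cfg) (g : List Bool → ℕ) : Prop where
  state : g stateVar = ν.state c.state
  cell : ∀ (j : ℕ) (z : ℤ), |z| ≤ s → (j : ℤ) = H + z - c.head → g (cell j) = ν.sym (c.tape z)

variable {ν} {s H : ℕ} {c c' : M.Cfg} {g g' : List Bool → ℕ}

theorem Describes.cell_head (h : ν.Describes s H c g) (hc : |c.head| ≤ s) :
    g (REWBLk.cell H) = ν.sym (c.tape c.head) :=
  h.cell H c.head hc (by omega)

/-- The tape position `z` is kept in cell `H + z - head`. With `z` and both heads within distance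
`s` of the origin and `2 * s ≤ H`, the old and new indices stay in the window, on the part of it for
which `StepRel` gives values. -/
theorem Describes.step (h : ν.Describes s H c g) (hH : 2 * s ≤ H) (hc : |c.head| ≤ s)
    (hc' : |c'.head| ≤ s) (hcc : M.Step c c')
    (hg : StepRel ν.rows H (ν.row (c.state, c.tape c.head)) g g') : ν.Describes s H c' g' := by
  obtain ⟨-, -, q, x, d, hδ, hq, hx, hd⟩ := hcc
  constructor
  · rw [hg.state', hq, row, hδ]
  · intro j z hz hj
    rw [hx]
    rw [abs_le] at hz hc hc'
    cases d with
    | left =>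
      simp only at hd
      -- A left move raises the index by one: the bounds on `z` and the old head make `j` positive,
      -- and the bound on the new head gives `i < H + H`.
      obtain ⟨i, rfl⟩ : ∃ i, j = i + 1 := ⟨j - 1, by omega⟩
      rw [hg.cell_up (by rw [row, hδ]; rfl) i (by omega)]
      by_cases hi : z = c.head
      · rw [if_pos (by omega), hi, Function.update_self, row, hδ]
      · rw [if_neg (by omega), Function.update_of_ne hi]
        exact h.cell i z (abs_le.2 hz) (by omega)
    | right =>
      simp only at hd
      rw [hg.cell_down (by rw [row, hδ]; rfl) j (by omega)]
      by_cases hi : z = c.head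
      · rw [if_pos (by omega), hi, Function.update_self, row, hδ]
      · rw [if_neg (by omega), Function.update_of_ne hi]
        exact h.cell (j + 1) z (abs_le.2 hz) (by omega)

/-- The numberings are injective, so the row is the one of the current state and scanned symbol; the
table omits the final states, hence the machine can move. -/
theorem exists_step {r : Row} (h : ν.Describes s H c g) (hc : |c.head| ≤ s)
    (hg : StepRel ν.rows H r g g') :
    r = ν.row (c.state, c.tape c.head) ∧ ∃ c', M.Step c c' := by
  obtain ⟨q, x, hq, hq', rfl⟩ := ν.mem_rows.1 hg.mem
  obtain rfl : c.state = q := ν.state_inj (h.state.symm.trans hg.state)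
  obtain rfl : c.tape c.head = x := ν.sym_inj ((h.cell_head hc).symm.trans hg.sym)
  refine ⟨rfl, ?_⟩
  rcases hδ : M.δ c.state (c.tape c.head) with ⟨q', x', d⟩
  exact ⟨⟨q', _, Function.update c.tape c.head x'⟩, hq, hq', q', x', d, hδ, rfl, rfl, rfl⟩

theorem describes_initial (w : List α)
    (h0 : g stateVar = ν.state M.start)
    (h1 : ∀ i, g (REWBLk.cell i) =
      if i < H then 0 else ((w.map fun a => ν.sym (M.input a))[i - H]?).getD 0) :
    ν.Describes s H (M.initial w) g := by
  refine ⟨h0, fun j z hz hj => ?_⟩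
  change (j : ℤ) = H + z - 0 at hj
  rw [h1]
  rcases z with i | i
  · rw [if_neg (by simp at hj; omega), show j - H = i by simp at hj; omega]
    simp only [DTM.initial]
    rw [List.getElem?_map]
    cases w[i]?
    · exact ν.sym_blank.symm
    · rfl
  · rw [if_pos (by simp at hj; omega)]
    exact ν.sym_blank.symm

/-- A simulation in both directions, with `Describes` as the invariant: iterations of the step
expression match computations of the machine, and the state variable shows acceptance. -/
theorem mem_language_simExpr {A : Type} {T F : A} (hTF : T ≠ F) (hK : 1 ≤ K) (ν : M.Numbering K)
    {w : List α} {s H : ℕ} (hs : M.space w ≤ s) (hH : 2 * s ≤ H) :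
    unaryWord T F K ∈ (simExpr T F K ν.rows (ν.state M.start) (ν.state M.accept) H
      (w.map fun a => ν.sym (M.input a))).language ↔
      ∃ c : M.Cfg, M.Reaches w c ∧ c.state = M.accept := by
  obtain ⟨Ri, hRi, hi⟩ := acts_inputExpr (T := T) (F := F) (K := K) H
    (l := w.map fun a => ν.sym (M.input a)) (by simp [ν.sym_le])
  obtain ⟨Rs, hRs, hs1, hs2⟩ := acts_stepExpr (T := T) hTF (ν.bounded_rows hK) hK H
  obtain ⟨g₀, hg₀, hg₀', hv, hcell⟩ := hi
    (Function.update (fun _ => 0) stateVar (ν.state M.start))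
  have hd₀ : ν.Describes s H (M.initial w) g₀ := by
    refine describes_initial w ?_ fun i => ?_
    · rw [hv _ fun _ => stateVar_ne_cell, Function.update_self]
    · rw [hcell, Function.update_of_ne stateVar_ne_cell.symm]
  have hfw : ∀ g, Relation.ReflTransGen Rs g₀ g → ∃ c, M.Reaches w c ∧ ν.Describes s H c g := by
    intro g hg
    induction hg with
    | refl => exact ⟨_, .refl, hd₀⟩
    | tail _ hg ih =>
      obtain ⟨c, hc, hd⟩ := ih
      obtain ⟨r, hr⟩ := hs1 _ _ hg
      have hb := M.abs_head_le hs hc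
      obtain ⟨rfl, c', hc'⟩ := exists_step hd hb hr
      exact ⟨c', hc.tail hc', hd.step hH hb (M.abs_head_le hs (hc.tail hc')) hc' hr⟩
  have hbw : ∀ c, M.Reaches w c → ∃ g, Relation.ReflTransGen Rs g₀ g ∧ ν.Describes s H c g := by
    intro c hc
    induction hc with
    | refl => exact ⟨_, .refl, hd₀⟩
    | @tail c c' hc hc' ih =>
      obtain ⟨g, hg, hd⟩ := ih
      have hb := M.abs_head_le hs hc
      obtain ⟨g', hg'⟩ := hs2 g (ν.row (c.state, c.tape c.head))
        (ν.mem_rows.2 ⟨_, _, hc'.1, hc'.2.1, rfl⟩) hd.state (hd.cell_head hb) (by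
          simp only [row]
          cases (M.δ c.state (c.tape c.head)).2.2
          · exact Or.inl rfl
          · exact Or.inr rfl)
      -- The row behind this step need not be the one put in, but the described configuration
      -- determines it.
      obtain ⟨r, hr⟩ := hs1 _ _ hg'
      obtain ⟨rfl, -⟩ := exists_step hd hb hr
      exact ⟨g', hg.tail hg', hd.step hH hb (M.abs_head_le hs (hc.tail hc')) hc' hr⟩
  have hsem := ((acts_setNum (T := T) (F := F) stateVar (ν.state_le M.start)).seq (hRi.seq
    (hRs.star.seq (acts_testNum hTF stateVar (ν.state_le M.accept))))).sem_eq (fun _ => 0)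
      (fun _ => Nat.zero_le K)
  have h0 : (fun _ => [] : List Bool → List A) = unaryAsg T (fun _ => 0) := rfl
  -- The final `word` moves the position and so is not covered by `Acts`; reassociating separates it
  -- from the four parts that are.
  have hassoc (E₁ E₂ E₃ E₄ E₅ : REWBLk A (List Bool)) (w : List A) (c) :
      sem w (.seq E₁ (.seq E₂ (.seq E₃ (.seq E₄ E₅)))) c =
        sem w (.seq (.seq E₁ (.seq E₂ (.seq E₃ E₄))) E₅) c := by
    simp only [sem, Set.biUnion_iUnion]
  have hmem : unaryWord T F K ∈ (simExpr T F K ν.rows (ν.state M.start) (ν.state M.accept) H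
      (w.map fun a => ν.sym (M.input a))).language ↔
      ∃ g, Relation.ReflTransGen Rs g₀ g ∧ g stateVar = ν.state M.accept := by
    change (∃ Λ, _ ∈ sem _ _ _) ↔ _
    rw [h0, simExpr]
    simp only [hassoc]
    rw [sem, hsem]
    simp only [Set.mem_iUnion, Set.mem_ofPred_eq, sem_word]
    constructor
    · rintro ⟨Λ, _, ⟨g, ⟨_, rfl, g₁, h1, g₂, h2, h3, rfl⟩, rfl⟩, -, -⟩
      obtain rfl := hg₀' _ h1
      exact ⟨g, h2, h3⟩
    · rintro ⟨g, h2, h3⟩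
      exact ⟨unaryAsg T g, _, ⟨g, ⟨_, rfl, g₀, hg₀, g, h2, h3, rfl⟩, rfl⟩, List.prefix_rfl,
        by simp⟩
  rw [hmem]
  constructor
  · rintro ⟨g, hg, h⟩
    obtain ⟨c, hc, hd⟩ := hfw g hg
    exact ⟨c, hc, ν.state_inj (hd.state.symm.trans h)⟩
  · rintro ⟨c, hc, h⟩
    obtain ⟨g, hg, hd⟩ := hbw c hc
    exact ⟨g, hg, hd.state.trans (congrArg _ h)⟩

end Numbering

end DTM

/-! ### Printing the expression of a space-bounded computation -/

namespace StackProg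

variable {α β : Type}

/-- Append a word to what has been written. -/
def Store.write (s : Store α β) (l : List β) : Store α β := { s with rev := l.reverse ++ s.rev }

theorem Runs.write {s : Store α β} (l : List β) : Runs (StackProg.emit l) s (s.write l) (l.length + 1) :=
  Runs.emit l

theorem Runs.writeCtr {s : Store α β} (x : β) (i : Ctr) (hi : i ≠ Ctr.t) (ht : s.t = 0) :
    Runs (StackProg.emitCtr x i) s (s.write (List.replicate (s.get i) x)) (5 * s.get i + 2) := by
  have h := Runs.emitCtr x i hi ht
  rwa [← List.reverse_replicate] at h

end StackProg

namespace SimPrinter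

open StackProg REWBLk

variable {A α : Type}

/-- Programs that read inputs of a machine and write expressions. -/
abbrev Prog (α A : Type) : Type := StackProg (Sym α (REWBLk.Token A))

/-- The stacks in use. -/
def store (i : List α) (r : List (REWBLk.Token A)) (n h k a b : ℕ) :
    Store α (REWBLk.Token A) :=
  ⟨i, [], r, [], n, h, k, a, b, 0⟩

/-- Count the input symbols. -/
def count : Prog α A := seq (forInp fun x => seq (save x) (inc Ctr.n)) (forInp2 unsave)

/-- Multiply a counter by the successor of another one. -/
def mult : Prog α A :=
  seq (forCtr Ctr.h (inc Ctr.a)) (forCtr Ctr.a (seq (inc Ctr.h)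
    (seq (forCtr Ctr.n (seq (inc Ctr.h) (inc Ctr.b))) (forCtr Ctr.b (inc Ctr.n)))))

/-- Multiply a counter by a power of the successor of another one. -/
def multPow : ℕ → Prog α A
  | 0 => skip
  | d + 1 => seq mult (multPow d)

/-- Increase a counter by a constant. -/
def addConst : ℕ → Prog α A
  | 0 => skip
  | c + 1 => seq (inc Ctr.h) (addConst c)

/-- Counting consumes the input, so it is saved on a second stack and moved back; the two reversals
cancel. -/
theorem runs_count (w : List α) :
    Runs count (Store.ofInp w : Store α (REWBLk.Token A)) (store w [] w.length 0 0 0 0)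
      (5 * w.length + 2) := by
  have h1 (w v : List α) (m : ℕ) : Runs (β := REWBLk.Token A)
      (forInp fun x => seq (save x) (inc Ctr.n)) ⟨w, v, [], [], m, 0, 0, 0, 0, 0⟩
      ⟨[], w.reverse ++ v, [], [], m + w.length, 0, 0, 0, 0, 0⟩ (3 * w.length + 1) := by
    induction w generalizing v m with
    | nil => exact Runs.loopInp_nil rfl
    | cons x w ih =>
      have h := Runs.loopInp_cons (brk := fun _ => false) (s := ⟨x :: w, v, [], [], m, 0, 0, 0, 0, 0⟩)
        rfl rfl ((Runs.save x).seq (Runs.inc Ctr.n)) (ih (x :: v) (m + 1))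
      rw [List.reverse_cons, List.append_assoc, List.singleton_append, List.length_cons,
        add_comm w.length, ← add_assoc]
      exact h.mono (by omega)
  have h2 (w v : List α) (m : ℕ) : Runs (β := REWBLk.Token A) (forInp2 unsave)
      ⟨v, w, [], [], m, 0, 0, 0, 0, 0⟩
      ⟨w.reverse ++ v, [], [], [], m, 0, 0, 0, 0, 0⟩ (2 * w.length + 1) := by
    induction w generalizing v m with
    | nil => exact Runs.loopInp2_nil rfl
    | cons x w ih =>
      have h := Runs.loopInp2_cons (s := ⟨v, x :: w, [], [], m, 0, 0, 0, 0, 0⟩)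
        rfl (Runs.unsave x) (ih (x :: v) m)
      rw [List.reverse_cons, List.append_assoc, List.singleton_append, List.length_cons]
      exact h.mono (by omega)
  have h := (h1 w [] 0).seq (h2 _ _ _)
  rw [List.append_nil, List.append_nil, List.reverse_reverse, List.length_reverse, zero_add] at h
  exact h.mono (by omega)

/-- The old value goes to `a`, and each unit of `a` adds `n + 1` to `h`; the counter `b` keeps a
copy of `n` from which it is restored after each round. -/
theorem runs_mult (i : List α) (n h : ℕ) :
    Runs (β := REWBLk.Token A) mult (store i [] n h 0 0 0) (store i [] n (h * (n + 1)) 0 0 0)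
      (h * (5 * n + 6) + 2) := by
  have h1 : Runs (β := REWBLk.Token A) (forCtr Ctr.h (inc Ctr.a)) (store i [] n h 0 0 0)
      (store i [] n 0 0 h 0) (h * 2 + 1) :=
    Runs.forCtr Ctr.h (fun m d => store i [] n m 0 d 0) 1 (fun _ _ => rfl)
      (fun m d => Runs.inc Ctr.a) h
  have h2 (m a : ℕ) : Runs (β := REWBLk.Token A) (forCtr Ctr.n (seq (inc Ctr.h) (inc Ctr.b)))
      (store i [] n m 0 a 0) (store i [] 0 (m + n) 0 a n) (n * 3 + 1) :=
    Runs.forCtr Ctr.n (fun n d => store i [] n (m + d) 0 a d) 2 (fun _ _ => rfl)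
      (fun _ d => (Runs.inc Ctr.h).seq (Runs.inc Ctr.b)) n
  have h3 (m a : ℕ) : Runs (β := REWBLk.Token A) (forCtr Ctr.b (inc Ctr.n))
      (store i [] 0 m 0 a n) (store i [] n m 0 a 0) (n * 2 + 1) :=
    Runs.forCtr Ctr.b (fun n d => store i [] d m 0 a n) 1 (fun _ _ => rfl)
      (fun _ d => Runs.inc Ctr.n) n
  have h4 : Runs (β := REWBLk.Token A) (forCtr Ctr.a (seq (inc Ctr.h)
      (seq (forCtr Ctr.n (seq (inc Ctr.h) (inc Ctr.b))) (forCtr Ctr.b (inc Ctr.n)))))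
      (store i [] n 0 0 h 0) (store i [] n (h * (n + 1)) 0 0 0) (h * (1 + (n * 3 + 1 + (n * 2 + 1)) + 1) + 1) := by
    have h5 := Runs.forCtr Ctr.a (fun a d => store i [] n (d * (n + 1)) 0 a 0) _ (fun _ _ => rfl)
      (fun a d => (Runs.inc Ctr.h).seq ((h2 (d * (n + 1) + 1) a).seq (by
        have h6 := h3 (d * (n + 1) + 1 + n) a
        rwa [show d * (n + 1) + 1 + n = (d + 1) * (n + 1) by ring] at h6 ⊢))) h
    simpa using h5
  exact (h1.seq h4).mono (le_of_eq (by ring))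

theorem runs_multPow (i : List α) (n h d : ℕ) :
    Runs (β := REWBLk.Token A) (multPow d) (store i [] n h 0 0 0)
      (store i [] n (h * (n + 1) ^ d) 0 0 0) (d * (h * (n + 1) ^ d * (5 * n + 6) + 2) + 1) := by
  induction d generalizing h with
  | zero =>
    rw [pow_zero, mul_one, zero_mul, zero_add]
    exact Exec.skip
  | succ d ih =>
    have h1 := (runs_mult (A := A) i n h).seq (ih _)
    rw [mul_assoc h, ← pow_succ'] at h1
    refine h1.mono ?_
    -- The product only grows (or stays `0`), so each of the multiplications is charged with the
    -- final value.
    have h2 : h * 1 * (5 * n + 6) ≤ h * (n + 1) ^ (d + 1) * (5 * n + 6) := by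
      gcongr
      exact Nat.one_le_pow _ _ (by omega)
    rw [mul_one] at h2
    rw [add_one_mul d]
    omega

theorem runs_addConst (i : List α) (n h c : ℕ) :
    Runs (β := REWBLk.Token A) (addConst c) (store i [] n h 0 0 0)
      (store i [] n (h + c) 0 0 0) (c + 1) := by
  induction c generalizing h with
  | zero => exact Exec.skip
  | succ c ih =>
    have h1 := (Runs.inc (s := store i [] n h 0 0 0) Ctr.h).seq (ih (h + 1))
    rw [show h + 1 + c = h + (c + 1) by omega] at h1
    exact h1.mono (by omega)

theorem runs_clear_n (i : List α) (n h : ℕ) :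
    Runs (β := REWBLk.Token A) (forCtr Ctr.n skip) (store i [] n h 0 0 0)
      (store i [] 0 h 0 0 0) (n * 2 + 1) :=
  Runs.forCtr Ctr.n (fun m _ => store i [] m h 0 0 0) 1 (fun _ _ => rfl) (fun _ _ => Exec.skip) n

theorem runs_clear_k (i : List α) (r : List (REWBLk.Token A)) (k h : ℕ) :
    Runs (forCtr Ctr.k skip) (store i r 0 h k 0 0)
      (store i r 0 h 0 0 0) (k * 2 + 1) :=
  Runs.forCtr Ctr.k (fun m _ => store i r 0 h m 0 0) 1 (fun _ _ => rfl) (fun _ _ => Exec.skip) k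

theorem runs_clear_a (i : List α) (r : List (REWBLk.Token A)) (a : ℕ) :
    Runs (forCtr Ctr.a skip) (store i r 0 0 0 a 0)
      (store i r 0 0 0 0 0) (a * 2 + 1) :=
  Runs.forCtr Ctr.a (fun m _ => store i r 0 0 0 m 0) 1 (fun _ _ => rfl) (fun _ _ => Exec.skip) a

theorem runs_double (i : List α) (r : List (REWBLk.Token A)) (h : ℕ) :
    Runs (forCtr Ctr.h (seq (inc Ctr.a) (inc Ctr.a))) (store i r 0 h 0 0 0)
      (store i r 0 0 0 (h + h) 0) (h * 3 + 1) :=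
  Runs.forCtr Ctr.h (fun m d => store i r 0 m 0 (d + d) 0) 2 (fun _ _ => rfl)
    (fun m d => by
      have h1 := (Runs.inc (s := store i r 0 m 0 (d + d) 0) Ctr.a).seq (Runs.inc Ctr.a)
      rw [show d + 1 + (d + 1) = d + d + 1 + 1 by omega]
      exact h1) h

end SimPrinter

/-! ### Printing the input and the shifts -/

namespace SimPrinter

open StackProg REWBLk

variable {A α : Type}

/-- The tokens of a number in unary. -/
def ones (A : Type) (m : ℕ) : List (REWBLk.Token A) := List.replicate m (.bit true)

theorem encodeName_cell (j : ℕ) : REWBLk.encodeName A (cell j) = ones A j ++ [.sep] := by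
  simp [REWBLk.encodeName, cell, ones]

/-- Print the expressions that store the input. -/
def inputProg (T : A) (x : α → ℕ) : Prog α A :=
  forInp fun y => seq (emit [.seq, .look, .capture]) (seq (emitCtr (.bit true) Ctr.h)
    (seq (emitCtr (.bit true) Ctr.k)
      (seq (emit (.sep :: REWBLk.encode (word (List.replicate (x y) T)))) (inc Ctr.k))))

/-- Print the expressions that move the tape contents up. -/
def upProg : Prog α A :=
  forCtr Ctr.a (seq (emit [.seq, .look, .capture]) (seq (emitCtr (.bit true) Ctr.a)
    (seq (emit [.bit true, .sep, .backref]) (seq (emitCtr (.bit true) Ctr.a)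
      (seq (emit [.sep]) (inc Ctr.b))))))

/-- Print the expressions that move the tape contents down. -/
def downProg : Prog α A :=
  forCtr Ctr.b (seq (emit [.seq, .look, .capture]) (seq (emitCtr (.bit true) Ctr.a)
    (seq (emit [.sep, .backref]) (seq (emitCtr (.bit true) Ctr.a)
      (seq (emit [.bit true, .sep]) (inc Ctr.a))))))

/-- The tokens written by `inputProg`. -/
def inputTokens (T : A) : ℕ → List ℕ → List (REWBLk.Token A)
  | _, [] => []
  | j, x :: l => [.seq, .look, .capture] ++ (ones A j ++
      ((.sep :: REWBLk.encode (word (V := List Bool) (List.replicate x T))) ++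
        inputTokens T (j + 1) l))

/-- The tokens written by `upProg`. -/
def upTokens (A : Type) : ℕ → List (REWBLk.Token A)
  | 0 => []
  | a + 1 => [.seq, .look, .capture] ++ (ones A a ++ ([.bit true, .sep, .backref] ++
      (ones A a ++ ([.sep] ++ upTokens A a))))

/-- The tokens written by `downProg`. -/
def downTokens (A : Type) : ℕ → ℕ → List (REWBLk.Token A)
  | _, 0 => []
  | a, b + 1 => [.seq, .look, .capture] ++ (ones A a ++ ([.sep, .backref] ++
      (ones A a ++ ([.bit true, .sep] ++ downTokens A (a + 1) b))))

theorem ones_succ (m : ℕ) : ones A (m + 1) = ones A m ++ [.bit true] := by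
  rw [ones, List.replicate_succ', ones]

theorem encode_inputExpr (T : A) (j : ℕ) (l : List ℕ) :
    REWBLk.encode (inputExpr T j l) = inputTokens T j l ++ [.eps] := by
  induction l generalizing j with
  | nil => rfl
  | cons x l ih => simp [inputExpr, REWBLk.encode, ih, setNum, encodeName_cell, inputTokens]

theorem encode_shiftUp (a : ℕ) :
    REWBLk.encode (shiftUp a : REWBLk A (List Bool)) = upTokens A a ++ [.eps] := by
  induction a with
  | zero => rfl
  | succ a ih =>
    simp [shiftUp, REWBLk.encode, ih, copyVar, encodeName_cell, upTokens, ones_succ]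

theorem encode_shiftDown (a b : ℕ) :
    REWBLk.encode (shiftDown a b : REWBLk A (List Bool)) = downTokens A a b ++ [.eps] := by
  induction b generalizing a with
  | zero => rfl
  | succ b ih =>
    simp [shiftDown, REWBLk.encode, ih, copyVar, encodeName_cell, downTokens, ones_succ]

/-- The name of cell `h + k` is printed as `h` ones and then `k` ones, where `k` counts the symbols
already read. The constant `B` bounds `k` throughout and makes the cost per symbol uniform. -/
theorem runs_inputProg (T : A) (x : α → ℕ) {K : ℕ} (hx : ∀ y, x y ≤ K) (B : ℕ) (w : List α)
    (r : List (REWBLk.Token A)) (h k : ℕ) (hB : k + w.length ≤ B) :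
    Runs (inputProg T x) (store w r 0 h k 0 0)
      (store [] ((inputTokens T (h + k) (w.map x)).reverse ++ r) 0 h (k + w.length) 0 0)
      (w.length * (5 * h + 5 * B + 2 * K + 20) + 1) := by
  induction w generalizing r k with
  | nil => exact Runs.mono (Runs.loopInp_nil (s := store [] r 0 h k 0 0) rfl) (by simp)
  | cons y w ih =>
    rw [List.length_cons] at hB
    let r' : List (REWBLk.Token A) :=
      (REWBLk.Token.sep :: REWBLk.encode (word (V := List Bool) (List.replicate (x y) T))).reverse ++
        ((ones A k).reverse ++ ((ones A h).reverse ++ ([.capture, .look, .seq] ++ r)))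
    have h1 := (Runs.write (s := store w r 0 h k 0 0) [.seq, .look, .capture]).seq
      ((Runs.writeCtr (.bit true) Ctr.h (by decide) rfl).seq
      ((Runs.writeCtr (.bit true) Ctr.k (by decide) rfl).seq
      ((Runs.write (.sep :: REWBLk.encode (word (V := List Bool) (List.replicate (x y) T)))).seq
        (Runs.inc Ctr.k))))
    have h2 := Runs.loopInp_cons (brk := fun _ => false) (s := store (y :: w) r 0 h k 0 0) rfl rfl
      h1 (ih r'
        (k + 1) (by omega))
    have e : (inputTokens T (h + (k + 1)) (w.map x)).reverse ++
        r' =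
        (inputTokens T (h + k) ((y :: w).map x)).reverse ++ r := by
      simp only [r', List.map_cons, inputTokens, ones, add_assoc]
      simp
      rw [← List.append_assoc, ← List.replicate_add, add_comm]
    rw [e, show k + 1 + w.length = k + (y :: w).length by simp; omega] at h2
    refine h2.mono ?_
    have hl (m : ℕ) : (REWBLk.encode (word (V := List Bool) (List.replicate m T))).length =
        2 * m + 1 := by
      induction m with
      | zero => rfl
      | succ m ih => simp [List.replicate_succ, word, REWBLk.encode, ih]; omega
    have := hx y
    have e1 : (store w r 0 h k 0 0).get Ctr.h = h := rfl
    have e2 : (store w r 0 h k 0 0).get Ctr.k = k := rfl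
    simp only [List.length_cons, List.length_nil, hl, add_one_mul, store, Store.write,
      Store.get]
    omega

/-- The loop counter doubles as the cell number: after the pop, `a` is the number of the source
cell. The rounds are collected in `b`, which then drives `downProg`. -/
theorem runs_upProg (w : List α) (r : List (REWBLk.Token A)) (a b B : ℕ) (hB : a ≤ B) :
    Runs upProg (store w r 0 0 0 a b) (store w ((upTokens A a).reverse ++ r) 0 0 0 0 (b + a))
      (a * (10 * B + 20) + 1) := by
  induction a generalizing r b with
  | zero => exact Runs.mono (Runs.forCtr_zero (s := store w r 0 0 0 0 b) (i := Ctr.a) rfl) (by simp)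
  | succ a ih =>
    let r' : List (REWBLk.Token A) := [.sep] ++ ((ones A a).reverse ++ ([.backref, .sep, .bit true] ++
        ((ones A a).reverse ++ ([.capture, .look, .seq] ++ r))))
    have h1 := (Runs.write (s := store w r 0 0 0 a b) [.seq, .look, .capture]).seq
      ((Runs.writeCtr (.bit true) Ctr.a (by decide) rfl).seq
      ((Runs.write [.bit true, .sep, .backref]).seq
      ((Runs.writeCtr (.bit true) Ctr.a (by decide) rfl).seq
      ((Runs.write [.sep]).seq (Runs.inc Ctr.b)))))
    have h2 := Runs.forCtr_succ (i := Ctr.a) (s := store w r 0 0 0 (a + 1) b) rfl h1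
      (ih r' (b + 1) (by omega))
    have e : (upTokens A a).reverse ++ r' =
        (upTokens A (a + 1)).reverse ++ r := by
      simp [r', upTokens]
    rw [e, show b + 1 + a = b + (a + 1) by omega] at h2
    refine h2.mono ?_
    simp only [List.length_cons, List.length_nil, add_one_mul, store, Store.write, Store.get]
    omega

/-- Here `b` counts the remaining rounds, while `a` grows and is the number of the target cell. -/
theorem runs_downProg (w : List α) (r : List (REWBLk.Token A)) (a b B : ℕ) (hB : a + b ≤ B) :
    Runs downProg (store w r 0 0 0 a b) (store w ((downTokens A a b).reverse ++ r) 0 0 0 (a + b) 0)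
      (b * (10 * B + 20) + 1) := by
  induction b generalizing r a with
  | zero => exact Runs.mono (Runs.forCtr_zero (s := store w r 0 0 0 a 0) (i := Ctr.b) rfl) (by simp)
  | succ b ih =>
    let r' : List (REWBLk.Token A) := [.sep, .bit true] ++ ((ones A a).reverse ++ ([.backref, .sep] ++
        ((ones A a).reverse ++ ([.capture, .look, .seq] ++ r))))
    have h1 := (Runs.write (s := store w r 0 0 0 a b) [.seq, .look, .capture]).seq
      ((Runs.writeCtr (.bit true) Ctr.a (by decide) rfl).seq
      ((Runs.write [.sep, .backref]).seq
      ((Runs.writeCtr (.bit true) Ctr.a (by decide) rfl).seq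
      ((Runs.write [.bit true, .sep]).seq (Runs.inc Ctr.a)))))
    have h2 := Runs.forCtr_succ (i := Ctr.b) (s := store w r 0 0 0 a (b + 1)) rfl h1
      (ih r' (a + 1) (by omega))
    have e : (downTokens A (a + 1) b).reverse ++ r' =
        (downTokens A a (b + 1)).reverse ++ r := by
      simp [r', downTokens]
    rw [e, show a + 1 + b = a + (b + 1) by omega] at h2
    refine h2.mono ?_
    simp only [List.length_cons, List.length_nil, add_one_mul, store, Store.write, Store.get]
    omega

theorem length_inputTokens_le (T : A) {K B j : ℕ} {l : List ℕ} (hl : ∀ x ∈ l, x ≤ K)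
    (hB : j + l.length ≤ B) : (inputTokens T j l).length ≤ l.length * (B + 2 * K + 5) := by
  have hw (m : ℕ) : (REWBLk.encode (word (V := List Bool) (List.replicate m T))).length =
      2 * m + 1 := by
    induction m with
    | zero => rfl
    | succ m ih => simp [List.replicate_succ, word, REWBLk.encode, ih]; omega
  induction l generalizing j with
  | nil => simp [inputTokens]
  | cons x l ih =>
    rw [List.length_cons] at hB
    have h1 := ih (j := j + 1) (fun x hx => hl x (by simp [hx])) (by omega)
    have h2 := hl x (by simp)
    simp only [inputTokens, ones, List.length_append, List.length_cons, List.length_nil, hw,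
      List.length_replicate, add_one_mul]
    omega

theorem length_upTokens_le {a B : ℕ} (hB : a ≤ B) :
    (upTokens A a).length ≤ a * (2 * B + 7) := by
  induction a with
  | zero => simp [upTokens]
  | succ a ih =>
    have h1 := ih (by omega)
    simp only [upTokens, ones, List.length_append, List.length_cons, List.length_nil,
      List.length_replicate, add_one_mul]
    omega

theorem length_downTokens_le {a b B : ℕ} (hB : a + b ≤ B) :
    (downTokens A a b).length ≤ b * (2 * B + 7) := by
  induction b generalizing a with
  | zero => simp [downTokens]
  | succ b ih =>
    have h1 := ih (a := a + 1) (by omega)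
    simp only [downTokens, ones, List.length_append, List.length_cons, List.length_nil,
      List.length_replicate, add_one_mul]
    omega

end SimPrinter

/-! ### Polynomial bounds -/

/-- Bounded by a polynomial. -/
def PolyBounded (f : ℕ → ℕ) : Prop := ∃ P : Polynomial ℕ, ∀ n, f n ≤ P.eval n

namespace PolyBounded

variable {f g : ℕ → ℕ}

theorem const (c : ℕ) : PolyBounded fun _ => c := ⟨Polynomial.C c, by simp⟩

theorem id : PolyBounded fun n => n := ⟨Polynomial.X, by simp⟩

theorem add (hf : PolyBounded f) (hg : PolyBounded g) : PolyBounded fun n => f n + g n := by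
  obtain ⟨P, hP⟩ := hf
  obtain ⟨Q, hQ⟩ := hg
  exact ⟨P + Q, fun n => by simpa using Nat.add_le_add (hP n) (hQ n)⟩

theorem mul (hf : PolyBounded f) (hg : PolyBounded g) : PolyBounded fun n => f n * g n := by
  obtain ⟨P, hP⟩ := hf
  obtain ⟨Q, hQ⟩ := hg
  exact ⟨P * Q, fun n => by simpa using Nat.mul_le_mul (hP n) (hQ n)⟩

theorem pow (hf : PolyBounded f) (d : ℕ) : PolyBounded fun n => f n ^ d := by
  obtain ⟨P, hP⟩ := hf
  exact ⟨P ^ d, fun n => by simpa using Nat.pow_le_pow_left (hP n) d⟩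

end PolyBounded

/-- Brings the space bound into a form that counters can compute by repeated multiplication. With `n
+ 1` as the base, powers increase with the exponent even at `n = 0`. -/
theorem Polynomial.exists_eval_le (p : Polynomial ℕ) :
    ∃ c d : ℕ, ∀ n, p.eval n ≤ c * (n + 1) ^ d := by
  induction p using Polynomial.induction_on' with
  | add p q hp hq =>
    obtain ⟨c, d, h⟩ := hp
    obtain ⟨c', d', h'⟩ := hq
    refine ⟨c + c', d + d', fun n => ?_⟩
    rw [Polynomial.eval_add, add_mul]
    refine Nat.add_le_add ((h n).trans ?_) ((h' n).trans ?_)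
    · exact Nat.mul_le_mul_left _ (Nat.pow_le_pow_right (by omega) (by omega))
    · exact Nat.mul_le_mul_left _ (Nat.pow_le_pow_right (by omega) (by omega))
  | monomial k a =>
    refine ⟨a, k, fun n => ?_⟩
    rw [Polynomial.eval_monomial]
    exact Nat.mul_le_mul_left _ (Nat.pow_le_pow_left (by omega) _)

/-! ### The complete printer and its running time -/

namespace SimPrinter

open StackProg REWBLk

variable {A α : Type}

/-- The expression and the word of a computation in which the head starts on the cell number `H`. -/
def simInstance (T F : A) (K : ℕ) (rs : List Row) (q₀ q₁ : ℕ) (x : α → ℕ) (H : ℕ) (w : List α) :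
    REWBLk A (List Bool) × List A :=
  (simExpr T F K rs q₀ q₁ H (w.map x), unaryWord T F K)

section

variable (T F : A) (K : ℕ) (rs : List Row) (q₀ q₁ : ℕ)

/-- The part of the output before the expressions that store the input. -/
def out₁ : List (REWBLk.Token A) := .seq :: (REWBLk.encode (setNum T stateVar q₀) ++ [.seq])

/-- The part of the output up to the first occurrence of the name of the head cell. -/
def out₂ (A : Type) : List (REWBLk.Token A) :=
  [.eps, .seq, .star, .seq, .look, .capture] ++ (REWBLk.encodeName A symVar ++ [.backref])

/-- The part of the output between the occurrences of the name of the head cell. -/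
def out₃ : List (REWBLk.Token A) :=
  [.sep, .seq] ++ (REWBLk.encode (tableExpr T F K rs) ++ [.seq, .look, .capture])

/-- The part of the output before the expressions that move the tape contents up. -/
def out₄ : List (REWBLk.Token A) :=
  [.sep, .backref] ++ (REWBLk.encodeName A symVar ++
    ([.alt, .seq] ++ REWBLk.encode (testNum T F K dirVar 0)))

/-- The part of the output before the expressions that move the tape contents down. -/
def out₅ : List (REWBLk.Token A) :=
  [.eps, .seq] ++ REWBLk.encode (testNum T F K dirVar 1)

/-- The end of the output. -/
def out₆ : List (REWBLk.Token A) :=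
  [.eps, .seq] ++ (REWBLk.encode (testNum T F K stateVar q₁) ++
    (REWBLk.encode (word (V := List Bool) (unaryWord T F K)) ++
      .sep :: (unaryWord T F K).map .sym))

/-- Cuts the output into six words that depend only on the machine and are emitted verbatim, and the
pieces between them that vary with the input and `H`. -/
theorem encodeInstance_simInstance (x : α → ℕ) (H : ℕ) (w : List α) :
    REWBLk.encodeInstance (simInstance T F K rs q₀ q₁ x H w) =
      out₁ T q₀ ++ (inputTokens T H (w.map x) ++ (out₂ A ++ (ones A H ++ (out₃ T F K rs ++
        (ones A H ++ (out₄ T F K ++ (upTokens A (H + H) ++ (out₅ T F K ++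
          (downTokens A 0 (H + H) ++ out₆ T F K q₁))))))))) := by
  simp [REWBLk.encodeInstance, simInstance, simExpr, REWBLk.encode, encode_inputExpr, stepExpr,
    copyVar, encodeName_cell, encode_shiftUp, encode_shiftDown, out₁, out₂, out₃, out₄, out₅, out₆]

/-- Compute the number `c * (n + 1) ^ d` of the head cell, where `n` is the length of the input. -/
def headProg (c d : ℕ) : Prog α A :=
  seq count <| seq (addConst c) <| seq (multPow d) (forCtr Ctr.n skip)

/-- Print the part of the expression that depends on the input. -/
def prepareProg (x : α → ℕ) : Prog α A :=
  seq (emit (out₁ T q₀)) <| seq (inputProg T x) (forCtr Ctr.k skip)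

/-- Print the part of the expression before the moves. -/
def tableProg : Prog α A :=
  seq (emit (out₂ A)) <| seq (emitCtr (.bit true) Ctr.h) <|
    seq (emit (out₃ T F K rs)) <| seq (emitCtr (.bit true) Ctr.h) (emit (out₄ T F K))

/-- Print the part of the expression with the moves. -/
def moveProg : Prog α A :=
  seq (forCtr Ctr.h (seq (inc Ctr.a) (inc Ctr.a))) <| seq upProg <|
    seq (emit (out₅ T F K)) <| seq downProg <| seq (emit (out₆ T F K q₁)) (forCtr Ctr.a skip)

/-- Print the instance of an input. -/
def prog (x : α → ℕ) (c d : ℕ) : Prog α A :=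
  seq (headProg c d) <| seq (prepareProg T q₀ x) <| seq (tableProg T F K rs) <|
    seq (moveProg T F K q₁) finish

/-- A bound for the time that `headProg` takes. -/
def headTime (c d n H : ℕ) : ℕ :=
  5 * n + 2 + (c + 1 + (d * (H * (5 * n + 6) + 2) + 1 + (n * 2 + 1)))

/-- A bound for the time that `prepareProg` takes. -/
def prepareTime (n H : ℕ) : ℕ :=
  (out₁ T q₀).length + 1 + (n * (5 * H + 5 * n + 2 * K + 20) + 1 + (n * 2 + 1))

/-- A bound for the time that `tableProg` takes. -/
def tableTime (H : ℕ) : ℕ :=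
  (out₂ A).length + 1 + (5 * H + 2 + ((out₃ T F K rs).length + 1 + (5 * H + 2 +
    ((out₄ T F K).length + 1))))

/-- A bound for the time that `moveProg` takes. -/
def moveTime (H : ℕ) : ℕ :=
  H * 3 + 1 + ((H + H) * (10 * (H + H) + 20) + 1 + ((out₅ T F K).length + 1 +
    ((H + H) * (10 * (H + H) + 20) + 1 + ((out₆ T F K q₁).length + 1 + ((H + H) * 2 + 1)))))

/-- A bound for the length of the output. -/
def outputLength (n H : ℕ) : ℕ :=
  (out₁ T q₀).length + n * (H + n + 2 * K + 5) + ((out₂ A).length + H + (out₃ T F K rs).length + H +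
    (out₄ T F K).length) + ((H + H) * (2 * (H + H) + 7) + (out₅ T F K).length +
    (H + H) * (2 * (H + H) + 7) + (out₆ T F K q₁).length)

/-- A bound for the time that printing takes, when the input has the length `n` and the head cell
has the number `H`. -/
def time (c d n H : ℕ) : ℕ :=
  headTime c d n H + (prepareTime T K q₀ n H + (tableTime T F K rs H + (moveTime T F K q₁ H +
    (outputLength T F K rs q₀ q₁ n H * 2 + 1))))

theorem runs_headProg (c d : ℕ) (w : List α) :
    Runs (headProg c d) (Store.ofInp w : Store α (REWBLk.Token A))
      (store w [] 0 (c * (w.length + 1) ^ d) 0 0 0)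
      (headTime c d w.length (c * (w.length + 1) ^ d)) := by
  have h0 := runs_addConst (A := A) w w.length 0 c
  rw [zero_add] at h0
  exact (runs_count w).seq (h0.seq ((runs_multPow w w.length c d).seq (runs_clear_n _ _ _)))

theorem runs_prepareProg {x : α → ℕ} (hx : ∀ y, x y ≤ K) (H : ℕ) (w : List α) :
    Runs (prepareProg T q₀ x) (store w [] 0 H 0 0 0)
      (store [] (out₁ T q₀ ++ inputTokens T H (w.map x)).reverse 0 H 0 0 0)
      (prepareTime T K q₀ w.length H) := by
  have h := runs_inputProg T x hx w.length w ((out₁ T q₀).reverse ++ []) H 0 (by omega)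
  rw [zero_add, add_zero] at h
  rw [List.reverse_append, ← List.append_nil (out₁ T q₀).reverse]
  exact (Runs.write _).seq (h.seq (runs_clear_k _ _ _ _))

theorem runs_tableProg (H : ℕ) (r : List (REWBLk.Token A)) :
    Runs (tableProg T F K rs) (store ([] : List α) r.reverse 0 H 0 0 0)
      (store [] (r ++ (out₂ A ++ (ones A H ++ (out₃ T F K rs ++ (ones A H ++
        out₄ T F K))))).reverse 0 H 0 0 0) (tableTime T F K rs H) := by
  have h := (Runs.write (s := store ([] : List α) r.reverse 0 H 0 0 0) (out₂ A)).seq <|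
    (Runs.writeCtr (.bit true) Ctr.h (by decide) rfl).seq <| (Runs.write (out₃ T F K rs)).seq <|
    (Runs.writeCtr (.bit true) Ctr.h (by decide) rfl).seq (Runs.write (out₄ T F K))
  simp only [List.reverse_append, List.append_assoc]
  exact h

theorem runs_moveProg (H : ℕ) (r : List (REWBLk.Token A)) :
    Runs (moveProg T F K q₁) (store ([] : List α) r.reverse 0 H 0 0 0)
      (store [] (r ++ (upTokens A (H + H) ++ (out₅ T F K ++
        (downTokens A 0 (H + H) ++ out₆ T F K q₁)))).reverse 0 0 0 0 0)
      (moveTime T F K q₁ H) := by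
  have h3 := runs_upProg ([] : List α) r.reverse (H + H) 0 (H + H) le_rfl
  have h4 (r : List (REWBLk.Token A)) :=
    runs_downProg ([] : List α) r 0 (H + H) (H + H) (by omega)
  simp only [zero_add] at h3 h4
  have h := (runs_double ([] : List α) r.reverse H).seq <| h3.seq <|
    (Runs.write (out₅ T F K)).seq <| (h4 _).seq <| (Runs.write (out₆ T F K q₁)).seq <|
    (runs_clear_a [] _ (H + H))
  simp only [List.reverse_append, List.append_assoc]
  exact h

theorem length_output_le {x : α → ℕ} (hx : ∀ y, x y ≤ K) (H : ℕ) (w : List α) :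
    (REWBLk.encodeInstance (simInstance T F K rs q₀ q₁ x H w)).length ≤
      outputLength T F K rs q₀ q₁ w.length H := by
  have hi : (inputTokens T H (w.map x)).length ≤ w.length * (H + w.length + 2 * K + 5) := by
    have := length_inputTokens_le T (K := K) (B := H + w.length) (j := H) (l := w.map x)
      (by simpa using fun a _ => hx a) (by simp)
    simpa using this
  have hu := length_upTokens_le (A := A) (le_refl (H + H))
  have hd := length_downTokens_le (A := A) (a := 0) (b := H + H) (B := H + H) (by omega)
  rw [encodeInstance_simInstance, outputLength]
  simp only [List.length_append, ones, List.length_replicate]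
  omega

theorem runs_prog {x : α → ℕ} (hx : ∀ y, x y ≤ K) (c d : ℕ) (w : List α) :
    Runs (prog T F K rs q₀ q₁ x c d) (Store.ofInp w)
      (Store.ofOut (REWBLk.encodeInstance
        (simInstance T F K rs q₀ q₁ x (c * (w.length + 1) ^ d) w)))
      (time T F K rs q₀ q₁ c d w.length (c * (w.length + 1) ^ d)) := by
  have h0 := runs_headProg (A := A) c d w
  have hl := length_output_le T F K rs q₀ q₁ hx (c * (w.length + 1) ^ d) w
  generalize c * (w.length + 1) ^ d = H at h0 hl ⊢
  have h1 := runs_moveProg (α := α) T F K q₁ H ((out₁ T q₀ ++ inputTokens T H (w.map x)) ++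
    (out₂ A ++ (ones A H ++ (out₃ T F K rs ++ (ones A H ++ out₄ T F K)))))
  have e : out₁ T q₀ ++ inputTokens T H (w.map x) ++
      (out₂ A ++ (ones A H ++ (out₃ T F K rs ++ (ones A H ++ out₄ T F K)))) ++
      (upTokens A (H + H) ++ (out₅ T F K ++ (downTokens A 0 (H + H) ++ out₆ T F K q₁))) =
      REWBLk.encodeInstance (simInstance T F K rs q₀ q₁ x H w) := by
    simp only [encodeInstance_simInstance, List.append_assoc]
  rw [e] at h1
  generalize REWBLk.encodeInstance (simInstance T F K rs q₀ q₁ x H w) = o at h1 hl ⊢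
  have h2 : Runs finish (store ([] : List α) o.reverse 0 0 0 0 0) (Store.ofOut o)
      (outputLength T F K rs q₀ q₁ w.length H * 2 + 1) := by
    have h := Runs.finish ([] : List α) [] o.reverse [] 0 0 0 0 0 0
    rw [List.reverse_reverse, List.append_nil, List.length_reverse] at h
    exact h.mono (by omega)
  exact h0.seq ((runs_prepareProg T K q₀ hx H w).seq ((runs_tableProg T F K rs H _).seq
    (h1.seq h2)))

theorem polyBounded_time (c d : ℕ) :
    PolyBounded fun n => time T F K rs q₀ q₁ c d n (c * (n + 1) ^ d) := by
  have hH : PolyBounded fun n => c * (n + 1) ^ d :=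
    (PolyBounded.const c).mul ((PolyBounded.id.add (PolyBounded.const 1)).pow d)
  simp only [time, headTime, prepareTime, tableTime, moveTime, outputLength]
  -- The time is a sum of products of constants, `n` and `H`; `hH` comes first so that `H` is
  -- treated as a unit.
  repeat' first
    | with_reducible exact hH
    | with_reducible exact PolyBounded.const _
    | with_reducible exact PolyBounded.id
    | with_reducible apply PolyBounded.add
    | with_reducible apply PolyBounded.mul

end

theorem polyTime [Finite A] [Finite α] (T F : A) (K : ℕ) (rs : List Row) (q₀ q₁ : ℕ) {x : α → ℕ}
    (hx : ∀ y, x y ≤ K) (c d : ℕ) :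
    PolyTime id id fun w : List α => REWBLk.encodeInstance
      (simInstance T F K rs q₀ q₁ x (c * (w.length + 1) ^ d) w) := by
  obtain ⟨P, hP⟩ := polyBounded_time T F K rs q₀ q₁ c d
  exact polyTime_of_runs (prog T F K rs q₀ q₁ x c d) P fun w =>
    (runs_prog T F K rs q₀ q₁ hx c d w).mono (hP w.length)

end SimPrinter

/-! ### PSPACE-hardness -/

namespace REWBLk

theorem encodeInstance_mem_membershipProblem {A : Type} {E : REWBLk A (List Bool)} {w : List A} :
    encodeInstance (E, w) ∈ membershipProblem A ↔ w ∈ E.language := by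
  constructor
  · rintro ⟨E', w', h, e⟩
    obtain ⟨rfl, rfl⟩ := Prod.ext_iff.1 (encodeInstance_injective e)
    exact h
  · exact fun h => ⟨E, w, h, rfl⟩

theorem pspaceHard_membershipProblem {A : Type} [Finite A] {T F : A} (hTF : T ≠ F) :
    PSPACEHard (membershipProblem A) := by
  rintro α _ L ⟨M, p, hM, hp⟩
  obtain ⟨K, hK, ⟨ν⟩⟩ := M.exists_numbering
  -- The factor `2` is the margin `2 * s ≤ H` of the simulation.
  obtain ⟨c, d, hcd⟩ := (Polynomial.C 2 * p).exists_eval_le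
  refine ⟨_, SimPrinter.polyTime T F K ν.rows (ν.state M.start) (ν.state M.accept)
    (x := fun a => ν.sym (M.input a)) (fun a => ν.sym_le _) c d, fun w => ?_⟩
  rw [hM.mem_iff, SimPrinter.simInstance, encodeInstance_mem_membershipProblem,
    DTM.Numbering.mem_language_simExpr hTF hK ν (hp w)]
  simpa using hcd w.length

end REWBLk

theorem theorem6 {A : Type} [Finite A] (T F : A) (hTF : T ≠ F) :
    PSPACEHard (REWBLk.membershipProblem A) ∧
    ∃ E : QBF → REWBLk A (List Bool),
      PolyTime QBF.encode REWBLk.encodeInstance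
        (fun Q : QBF => (E Q, tfWord T F Q.quants.length Q.clauses.length)) ∧
      ∀ Q : QBF, Q.IsTrue ↔
        tfWord T F Q.quants.length Q.clauses.length ∈ (E Q).language :=
  ⟨REWBLk.pspaceHard_membershipProblem hTF, REWBLk.ofQBF T F, QBFPrinter.polyTime T F,
    REWBLk.isTrue_iff_mem_language hTF⟩
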